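/- For $\alpha\in[0,1]$ and $V\in\mathbb R$ let $H_{\alpha,V}$ be the self-adjoint operator on $\ell^2(\mathbb Z)$ given by $$(H_{\alpha,V}\psi)(n)=\psi(n-1)+\psi(n+1)+V\chi_{[1-\alpha,1)}(\{n\alpha\})\,\psi(n),\qquad n\in\mathbb Z,$$ where $\{x\}=x-\lfloor x\rfloor$, and let $\sigma(H_{\alpha,V})\subset\mathbb R$ be its spectrum. Let $V>0$, let $\alpha\in[0,1]$ be irrational with continued fraction expansion $\alpha=[0,a_1,a_2,\dots]$, and put $\alpha_k=[0,a_1,\dots,a_k]$ for $k\ge 0$ (so $\alpha_0=0$). The spectral bands at level $k\ge0$ are the maximal intervals (connected components) of $\sigma(H_{\alpha_k,V})$; at level $-1$ there is, by convention, exactly one band, namely $\mathbb R$. An interval $[a,b]$ is strictly contained in $[c,d]$ if $c<a$ and $b<d$, and every compact interval is strictly contained in $\mathbb R$. Write $[a,b]\prec[c,d]$ if $a<c$ and $b<d$. A spectral band $I$ at level $k\ge0$ is of type A if it is strictly contained in a spectral band at level $k-1$; it is of type B if it is not of type A and is strictly contained in a spectral band at level $k-2$ (for $k\ge 1$). Then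 for every $k\ge0$: (a) Every spectral band of $\sigma(H_{\alpha_k,V})$ is either of type A or of type B. (b) Let $I$ be a spectral band of $\sigma(H_{\alpha_k,V})$, and let $p=a_{k+1}-1$ if $I$ is of type A and $p=a_{k+1}$ if $I$ is of type B. Then there exist $p$ spectral bands $J^{(1)},\dots,J^{(p)}$ of type A in $\sigma(H_{\alpha_{k+1},V})$ and $p+1$ spectral bands $K^{(1)},\dots,K^{(p+1)}$ of type B in $\sigma(H_{\alpha_{k+2},V})$, all strictly contained in $I$, which interlace: $$K^{(j)}\prec J^{(j)}\prec K^{(j+1)},\qquad 1\le j\le p.$$ -/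

import Mathlib

noncomputable section

namespace Sturmian

/-- The Hilbert space `ℓ²(ℤ)` of square-summable complex sequences indexed by the integers. -/
abbrev Ell2 : Type := lp (fun _ : ℤ => ℂ) 2

theorem summable_shift (ψ : Ell2) (m : ℤ) :
    Summable fun n : ℤ => ‖ψ (n + m)‖ ^ (2 : ENNReal).toReal :=
  (Equiv.addRight m).summable_iff.mpr ((lp.memℓp ψ).summable (by norm_num))

/-- The translation `(S ψ)(n) = ψ(n + m)` as a bounded operator on `ℓ²(ℤ)`. -/
def shift (m : ℤ) : Ell2 →L[ℂ] Ell2 :=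
  LinearMap.mkContinuous
    { toFun := fun ψ => ⟨fun n => ψ (n + m), memℓp_gen (summable_shift ψ m)⟩
      map_add' := fun _ _ => rfl
      map_smul' := fun _ _ => rfl }
    1
    (fun ψ => by
      rw [one_mul]
      refine lp.norm_le_of_tsum_le (by norm_num) (norm_nonneg _) ?_
      rw [lp.norm_rpow_eq_tsum (by norm_num) ψ]
      exact ((Equiv.addRight m).tsum_eq
        (fun n => ‖ψ n‖ ^ (2 : ENNReal).toReal)).le)

/-- The Sturmian potential `n ↦ V χ_{[1 - α, 1)}({n α})`. -/
def potential (α V : ℝ) (n : ℤ) : ℝ :=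
  (Set.Ico (1 - α) 1).indicator (fun _ => V) (Int.fract ((n : ℝ) * α))

theorem norm_potential_mul_le (α V : ℝ) (n : ℤ) (z : ℂ) :
    ‖(potential α V n : ℂ) * z‖ ≤ ‖(V : ℂ) * z‖ := by
  rw [norm_mul, norm_mul, Complex.norm_real, Complex.norm_real]
  exact mul_le_mul_of_nonneg_right (norm_indicator_le_norm_self (fun _ => V) _) (norm_nonneg _)

/-- Multiplication by the Sturmian potential as a bounded operator on `ℓ²(ℤ)`. -/
def potentialOp (α V : ℝ) : Ell2 →L[ℂ] Ell2 :=
  LinearMap.mkContinuous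
    { toFun := fun ψ => ⟨fun n => (potential α V n : ℂ) * ψ n,
        Memℓp.mono (g := fun n => ‖(V : ℂ) * ψ n‖)
          (memℓp_norm_iff.mpr ((lp.memℓp ψ).const_mul (V : ℂ)))
          (fun n => norm_potential_mul_le α V n (ψ n))⟩
      map_add' := fun ψ φ => lp.ext (funext fun n => mul_add _ (ψ n) (φ n))
      map_smul' := fun c ψ => lp.ext (funext fun n => mul_left_comm _ c (ψ n)) }
    ‖(V : ℂ)‖
    (fun ψ => by
      rw [← norm_smul]
      exact lp.norm_mono (p := 2) (by norm_num)
        (fun n => norm_potential_mul_le α V n (ψ n)))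

/-- The Schrödinger operator
`(H ψ)(n) = ψ(n - 1) + ψ(n + 1) + V χ_{[1 - α, 1)}({n α}) ψ(n)` on `ℓ²(ℤ)`. -/
def hamiltonian (α V : ℝ) : Ell2 →L[ℂ] Ell2 :=
  shift (-1) + shift 1 + potentialOp α V

theorem hamiltonian_apply (α V : ℝ) (ψ : Ell2) (n : ℤ) :
    hamiltonian α V ψ n = ψ (n - 1) + ψ (n + 1) + (potential α V n : ℂ) * ψ n := rfl

/-- The spectrum of the (self-adjoint) operator `H_{α,V}`, as a set of real numbers. -/
def spec (α V : ℝ) : Set ℝ := {E : ℝ | (E : ℂ) ∈ spectrum ℂ (hamiltonian α V)}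

/-- The coefficient `a_k` of the continued fraction expansion `α = [a_0, a_1, a_2, …]`
(for irrational `α ≥ 0`, all coefficients exist and are natural numbers). -/
def cfCoeff (α : ℝ) : ℕ → ℕ
  | 0 => ⌊(GenContFract.of α).h⌋₊
  | k + 1 => ⌊((GenContFract.of α).partDens.get? k).getD 0⌋₊

/-- The finite continued fraction `α_k = [0, a_1, …, a_k]`, for `α ∈ [0, 1)`. -/
def approximant (α : ℝ) (k : ℕ) : ℝ := (GenContFract.of α).convs k

/-- The spectrum at level `k` of the hierarchy of periodic approximations: it is `σ(H_{α_k,V})` for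
`k ≥ 0`, and the whole line below level `0` (the root of the hierarchy, at level `-1`, is `ℝ`). -/
def levelSpec (α V : ℝ) : ℤ → Set ℝ
  | Int.ofNat k => spec (approximant α k) V
  | Int.negSucc _ => Set.univ

/-- The spectral bands at level `k`: the maximal intervals (connected components)
of the spectrum. -/
def IsBand (α V : ℝ) (k : ℤ) (I : Set ℝ) : Prop :=
  ∃ E ∈ levelSpec α V k, I = connectedComponentIn (levelSpec α V k) E

/-- Strict containment of closed intervals: `[a, b]` is strictly contained in `[c, d]` if `c < a`
and `b < d`; every compact interval is strictly contained in `ℝ`. -/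
def StrictlyIn (I J : Set ℝ) : Prop := I ⊆ interior J

/-- A spectral band at level `k` is of type A if it is strictly contained in a spectral band
at level `k - 1`. -/
def IsTypeA (α V : ℝ) (k : ℤ) (I : Set ℝ) : Prop :=
  IsBand α V k I ∧ ∃ J, IsBand α V (k - 1) J ∧ StrictlyIn I J

/-- A spectral band at level `k` is of type B if it is not of type A and it is strictly contained in
a spectral band at level `k - 2`. -/
def IsTypeB (α V : ℝ) (k : ℤ) (I : Set ℝ) : Prop :=
  IsBand α V k I ∧ ¬ IsTypeA α V k I ∧ ∃ J, IsBand α V (k - 2) J ∧ StrictlyIn I J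

/-- The order on compact intervals: `[a, b] ≺ [c, d]` if `a < c` and `b < d`. -/
def Precedes (I J : Set ℝ) : Prop :=
  ∃ a b c d : ℝ, a ≤ b ∧ c ≤ d ∧ I = Set.Icc a b ∧ J = Set.Icc c d ∧ a < c ∧ b < d

/-- The band `I` at level `k` strictly contains `p` bands `J` of type A from level `k + 1` and
`p + 1` bands `K` of type B from level `k + 2`, which interlace. -/
def HasInterlacingBands (α V : ℝ) (k : ℤ) (I : Set ℝ) (p : ℕ) : Prop :=
  ∃ (J : Fin p → Set ℝ) (K : Fin (p + 1) → Set ℝ),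
    (∀ j, IsTypeA α V (k + 1) (J j) ∧ StrictlyIn (J j) I) ∧
    (∀ j, IsTypeB α V (k + 2) (K j) ∧ StrictlyIn (K j) I) ∧
    ∀ j : Fin p, Precedes (K j.castSucc) (J j) ∧ Precedes (J j) (K j.succ)

end Sturmian

end

noncomputable section

namespace Sturmian

open Polynomial

/-! The spectrum at level `k` is the set where the trace polynomial `t_k` of the monodromy matrix
`M_k` satisfies `|t_k| ≤ 2`, so everything reduces to the polynomials `t_k`, of degree at most
`q_k`. The engine is an angular coordinate. Let `y = t_k` and let `u_n` solve `u_{n+2} = y u_{n+1} -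
u_n`; in the main case `u_n = tr(M_{k-1} M_k^n)`. The Fricke–Vogt invariant `u_0² + u_1² + y² - y
u_0 u_1 = 4 + V²` fixes the amplitude of the solution, and on a band of `y` where `|u_0| ≤ 2` one
gets `u_n sin γ = ±2 cos(φ + nθ)`, with `θ` going from `0` to `π` across the band and `0 ≤ γ < π/2`
(`exists_phase`). Away from the points where `sin θ = 0`, `|u_n| ≤ 2` means that `φ + nθ` is within
`γ` of `π/2` modulo `π`. Since `φ + nθ` goes from `π/2` to `π/2 + nπ`, it passes through `n - 1`
interior windows, by continuity alone (`Phase.exists_window`). Comparing the phases for `p + 1` and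
`p + 2` gives `p` and `p + 1` interlacing intervals (`exists_interlacing_crossings`).

A band of type A has `|t_{k-1}| ≤ 2`, so `u_0 = t_{k-1}` is admissible and `p + 1 = a_{k+1}`. A band
of type B has instead `|tr(M_{k-1} M_k⁻¹)| ≤ 2`; starting the sequence one step earlier gives `p =
a_{k+1}`. The intervals for index `p + 1` are bands of `t_{k+1}`. Those for `p + 2` are intervals
for `tr(M_k M_{k+1})`, and each contains a band of `t_{k+2}` of type B (`exists_crossingB`).

That no other bands exist is a count (`convDen_le_card`): the bands produced at level `k` number
`q_k`, and each takes every value in `[-2, 2]`, so by the degree bound nothing with `|t_k| ≤ 2` lies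
outside them (`exists_mem_crossing`).

The link with the operator is Floquet theory (`mem_spec_iff`) together with the concatenation rule
of mechanical words, which gives `M_{k+1} = M_{k-1} M_k^{a_{k+1}}` (`monodromy_add_two`). -/

/-! ### Angular coordinates inside a band -/

/-- `[c, d]` is a maximal interval on which `|u| ≤ 2`, and `u` takes the values `2` and `-2` at its
endpoints. -/
structure Crossing (u : ℝ → ℝ) (c d : ℝ) : Prop where
  lt : c < d
  le : ∀ x ∈ Set.Icc c d, |u x| ≤ 2
  abs_left : |u c| = 2
  opp : u d = -u c
  accL : ∀ ε > 0, ∃ x ∈ Set.Ioo (c - ε) c, 2 < |u x|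
  accR : ∀ ε > 0, ∃ x ∈ Set.Ioo d (d + ε), 2 < |u x|

/-- Angular coordinates on `[a, b]` for a sequence `u` of functions with `u n = ± 2 cos (φ + n θ) / sin γ`. -/
structure Phase (u : ℕ → ℝ → ℝ) (a b : ℝ) (θ φ γ : ℝ → ℝ) (s : ℕ → ℝ) : Prop where
  contθ : Continuous θ
  contφ : Continuous φ
  contγ : Continuous γ
  sign : ∀ n, |s n| = 1
  left : θ a = 0
  right : θ b = Real.pi
  memθ : ∀ x ∈ Set.Icc a b, 0 ≤ θ x ∧ θ x ≤ Real.pi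
  memγ : ∀ x ∈ Set.Icc a b, 0 ≤ γ x ∧ γ x < Real.pi / 2
  memφ : ∀ x ∈ Set.Icc a b, 0 < φ x ∧ φ x < Real.pi
  pos : ∀ x ∈ Set.Icc a b, θ x ≠ 0 → θ x ≠ Real.pi → 0 < γ x
  degenerate : ∀ x ∈ Set.Icc a b, θ x = 0 ∨ θ x = Real.pi → γ x = 0 ∧ φ x = Real.pi / 2
  rel : ∀ n : ℕ, ∀ x ∈ Set.Icc a b,
    u n x * Real.sin (γ x) = 2 * s n * Real.cos (φ x + n * θ x)

theorem exists_constant_sign {f : ℝ → ℝ} {a b : ℝ} (hab : a ≤ b) (hf : Continuous f)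
    (h0 : ∀ x ∈ Set.Icc a b, f x ≠ 0) :
    ∃ τ : ℝ, τ ^ 2 = 1 ∧ ∀ x ∈ Set.Icc a b, 0 < τ * f x := by
  have key : ∀ g : ℝ → ℝ, Continuous g → (∀ x ∈ Set.Icc a b, g x ≠ 0) → 0 < g a →
      ∀ x ∈ Set.Icc a b, 0 < g x := by
    intro g hg hg0 hga x hx
    by_contra hneg
    obtain ⟨z, hz, hz0⟩ := intermediate_value_Icc' hx.1 hg.continuousOn
      (show (0 : ℝ) ∈ Set.Icc (g x) (g a) from ⟨not_lt.mp hneg, hga.le⟩)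
    exact hg0 z ⟨hz.1, hz.2.trans hx.2⟩ hz0
  rcases lt_or_gt_of_ne (h0 a ⟨le_rfl, hab⟩) with h | h
  · refine ⟨-1, by norm_num, fun x hx => ?_⟩
    have := key (fun x => -f x) hf.neg (fun x hx => neg_ne_zero.mpr (h0 x hx)) (by simpa using h) x hx
    linarith
  · exact ⟨1, by norm_num, fun x hx => by simpa using key f hf h0 h x hx⟩

/-- Write `y = 2σ cos θ`, with the sign `σ = y(a)/2` chosen so that `θ` starts at `0`. Then `τ σⁿ
u_n sin θ` obeys the recursion of `cos(φ + nθ)`, and the invariant gives it the amplitude `D = √(V²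
+ 4 sin² θ)`. It also reads `(u_0 y/2 - u_1)² = V² + (4 - u_0²)(4 - y²)/4 ≥ V² > 0`, so this
expression has a constant sign; `τ` absorbs it, and `sin φ > 0` throughout. The angle `γ` is defined
by `D sin γ = 2 sin θ`. -/
theorem exists_phase {V : ℝ} (hV : 0 < V) {y : ℝ → ℝ} {u : ℕ → ℝ → ℝ} {a b : ℝ} (hab : a ≤ b)
    (hy : Continuous y) (hu0 : Continuous (u 0)) (hu1 : Continuous (u 1))
    (hrec : ∀ n x, u (n + 2) x = y x * u (n + 1) x - u n x)
    (hinv : ∀ x, u 0 x ^ 2 + u 1 x ^ 2 + y x ^ 2 - y x * u 0 x * u 1 x = 4 + V ^ 2)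
    (hle : ∀ x ∈ Set.Icc a b, |y x| ≤ 2) (hya : |y a| = 2) (hyb : y b = -y a)
    (h0 : ∀ x ∈ Set.Icc a b, |u 0 x| ≤ 2) :
    ∃ θ φ γ s, Phase u a b θ φ γ s := by
  obtain ⟨σ, hσ⟩ : ∃ σ : ℝ, σ = y a / 2 := ⟨_, rfl⟩
  have hσ2 : σ ^ 2 = 1 := by
    have : y a ^ 2 = 4 := by rw [← sq_abs, hya]; norm_num
    rw [hσ]; linarith
  have hσabs : |σ| = 1 := by
    rw [hσ, abs_div, hya]; norm_num
  have hq : ∀ x ∈ Set.Icc a b, V ^ 2 ≤ (σ * (u 0 x * y x / 2 - u 1 x)) ^ 2 := by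
    intro x hx
    have h1 : y x ^ 2 ≤ 4 := by
      have := sq_le_sq' (abs_le.mp (hle x hx)).1 (abs_le.mp (hle x hx)).2; linarith
    have h2 : u 0 x ^ 2 ≤ 4 := by
      have := sq_le_sq' (abs_le.mp (h0 x hx)).1 (abs_le.mp (h0 x hx)).2; linarith
    have h3 := mul_nonneg (sub_nonneg.mpr h1) (sub_nonneg.mpr h2)
    rw [mul_pow, hσ2]
    nlinarith [hinv x]
  obtain ⟨τ, hτ2, hτ⟩ := exists_constant_sign (f := fun x => σ * (u 0 x * y x / 2 - u 1 x)) hab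
    (by fun_prop) (fun x hx h => by
      have := hq x hx
      rw [h] at this
      nlinarith)
  obtain ⟨θ, hθ⟩ : ∃ θ : ℝ → ℝ, θ = fun x => Real.arccos (σ * y x / 2) := ⟨_, rfl⟩
  obtain ⟨D, hD⟩ : ∃ D : ℝ → ℝ, D = fun x => √(V ^ 2 + 4 * Real.sin (θ x) ^ 2) := ⟨_, rfl⟩
  have hθc : Continuous θ := by
    rw [hθ]; exact Real.continuous_arccos.comp (by fun_prop)
  have hDc : Continuous D := by rw [hD]; fun_prop
  have hDpos : ∀ x, 0 < D x := by
    intro x; rw [hD]; exact Real.sqrt_pos.mpr (by positivity)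
  have hDsq : ∀ x, D x ^ 2 = V ^ 2 + 4 * Real.sin (θ x) ^ 2 := by
    intro x; rw [hD]; exact Real.sq_sqrt (by positivity)
  have hθmem : ∀ x, 0 ≤ θ x ∧ θ x ≤ Real.pi := by
    intro x; rw [hθ]; exact ⟨Real.arccos_nonneg _, Real.arccos_le_pi _⟩
  have hsin : ∀ x, 0 ≤ Real.sin (θ x) := fun x =>
    Real.sin_nonneg_of_nonneg_of_le_pi (hθmem x).1 (hθmem x).2
  have h2lt : ∀ x, 2 * Real.sin (θ x) < D x := by
    intro x
    have := hDsq x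
    nlinarith [hDpos x, hsin x]
  have hcos : ∀ x ∈ Set.Icc a b, Real.cos (θ x) = σ * y x / 2 := by
    intro x hx
    have : |σ * y x / 2| ≤ 1 := by
      rw [abs_div, abs_mul, hσabs, abs_two]; linarith [hle x hx]
    rw [hθ]
    exact Real.cos_arccos (abs_le.mp this).1 (abs_le.mp this).2
  obtain ⟨φ, hφ⟩ : ∃ φ : ℝ → ℝ, φ = fun x => Real.arccos (τ * u 0 x * Real.sin (θ x) / D x) :=
    ⟨_, rfl⟩
  obtain ⟨γ, hγ⟩ : ∃ γ : ℝ → ℝ, γ = fun x => Real.arcsin (2 * Real.sin (θ x) / D x) := ⟨_, rfl⟩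
  have hφc : Continuous φ := by
    rw [hφ]
    exact Real.continuous_arccos.comp
      (Continuous.div (by fun_prop) hDc (fun x => (hDpos x).ne'))
  have hγc : Continuous γ := by
    rw [hγ]
    exact Real.continuous_arcsin.comp
      (Continuous.div (by fun_prop) hDc (fun x => (hDpos x).ne'))
  have hτabs : |τ| = 1 := by
    rw [← sq_eq_sq₀ (abs_nonneg _) zero_le_one, sq_abs, hτ2]; norm_num
  have hφarg : ∀ x ∈ Set.Icc a b, |τ * u 0 x * Real.sin (θ x) / D x| < 1 := by
    intro x hx
    rw [abs_div, abs_mul, abs_mul, hτabs, abs_of_nonneg (hsin x), abs_of_pos (hDpos x),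
      div_lt_one (hDpos x), one_mul]
    exact (mul_le_mul_of_nonneg_right (h0 x hx) (hsin x)).trans_lt (h2lt x)
  have hcosφ : ∀ x ∈ Set.Icc a b, D x * Real.cos (φ x) = τ * u 0 x * Real.sin (θ x) := by
    intro x hx
    have := abs_lt.mp (hφarg x hx)
    rw [hφ]
    simp only
    rw [Real.cos_arccos this.1.le this.2.le, mul_div_cancel₀ _ (hDpos x).ne']
  have hφmem : ∀ x ∈ Set.Icc a b, 0 < φ x ∧ φ x < Real.pi := by
    intro x hx
    have := abs_lt.mp (hφarg x hx)
    rw [hφ]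
    exact ⟨Real.arccos_pos.mpr this.2, Real.arccos_lt_pi.mpr this.1⟩
  have hγarg0 : ∀ x, 0 ≤ 2 * Real.sin (θ x) / D x := fun x =>
    div_nonneg (mul_nonneg zero_le_two (hsin x)) (hDpos x).le
  have hγarg1 : ∀ x, 2 * Real.sin (θ x) / D x < 1 := fun x => by
    rw [div_lt_one (hDpos x)]; exact h2lt x
  have hsinγ : ∀ x, D x * Real.sin (γ x) = 2 * Real.sin (θ x) := by
    intro x
    rw [hγ]
    simp only
    rw [Real.sin_arcsin (by linarith [hγarg0 x]) (hγarg1 x).le, mul_div_cancel₀ _ (hDpos x).ne']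
  have hsinφ : ∀ x ∈ Set.Icc a b,
      D x * Real.sin (φ x) = τ * (σ * (u 0 x * y x / 2 - u 1 x)) := by
    intro x hx
    have hp : 0 ≤ D x * Real.sin (φ x) := mul_nonneg (hDpos x).le
      (Real.sin_nonneg_of_nonneg_of_le_pi (hφmem x hx).1.le (hφmem x hx).2.le)
    rw [← sq_eq_sq₀ hp (hτ x hx).le]
    have e1 : (D x * Real.sin (φ x)) ^ 2 = D x ^ 2 - (D x * Real.cos (φ x)) ^ 2 := by
      rw [mul_pow, Real.sin_sq]; ring
    have e2 : Real.sin (θ x) ^ 2 = 1 - y x ^ 2 / 4 := by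
      rw [Real.sin_sq, hcos x hx]
      linear_combination (-(y x ^ 2 / 4)) * hσ2
    rw [e1, hcosφ x hx, hDsq x]
    have e3 : (τ * u 0 x * Real.sin (θ x)) ^ 2 = u 0 x ^ 2 * (1 - y x ^ 2 / 4) := by
      rw [← e2]; linear_combination (u 0 x ^ 2 * Real.sin (θ x) ^ 2) * hτ2
    have e4 : (τ * (σ * (u 0 x * y x / 2 - u 1 x))) ^ 2 = (u 0 x * y x / 2 - u 1 x) ^ 2 := by
      rw [mul_pow, mul_pow, hτ2, hσ2]; ring
    rw [e3, e4, e2]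
    linear_combination -(hinv x)
  have hrel : ∀ n : ℕ, ∀ x ∈ Set.Icc a b,
      u n x * σ ^ n * τ * Real.sin (θ x) = D x * Real.cos (φ x + n * θ x) ∧
      u (n + 1) x * σ ^ (n + 1) * τ * Real.sin (θ x)
        = D x * Real.cos (φ x + (n + 1 : ℕ) * θ x) := by
    intro n x hx
    induction n with
    | zero =>
      constructor
      · simp only [pow_zero, Nat.cast_zero, zero_mul, add_zero]
        rw [hcosφ x hx]; ring
      · simp only [zero_add, pow_one, Nat.cast_one, one_mul]
        rw [Real.cos_add]
        linear_combination (-Real.cos (θ x)) * hcosφ x hx + Real.sin (θ x) * hsinφ x hx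
          - (τ * u 0 x * Real.sin (θ x)) * hcos x hx
    | succ n ih =>
      refine ⟨ih.2, ?_⟩
      have hc : Real.cos (φ x + ((n + 1 + 1 : ℕ) : ℝ) * θ x)
          = 2 * Real.cos (θ x) * Real.cos (φ x + ((n + 1 : ℕ) : ℝ) * θ x)
            - Real.cos (φ x + (n : ℝ) * θ x) := by
        have h1 : φ x + ((n + 1 + 1 : ℕ) : ℝ) * θ x = (φ x + ((n + 1 : ℕ) : ℝ) * θ x) + θ x := by
          push_cast; ring
        have h2 : φ x + (n : ℝ) * θ x = (φ x + ((n + 1 : ℕ) : ℝ) * θ x) - θ x := by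
          push_cast; ring
        rw [h1, h2, Real.cos_add, Real.cos_sub]; ring
      rw [hc, hrec]
      have e := hcos x hx
      linear_combination (2 * Real.cos (θ x)) * ih.2 - ih.1
        - (2 * u (n + 1) x * σ ^ (n + 1) * τ * Real.sin (θ x)) * e
        - (u n x * σ ^ n * τ * Real.sin (θ x)) * hσ2
  have hy2 : y a ^ 2 = 4 := by rw [← sq_abs, hya]; norm_num
  have hends : ∀ x, θ x = 0 ∨ θ x = Real.pi → Real.sin (θ x) = 0 := by
    rintro x (h | h) <;> simp [h]
  refine ⟨θ, φ, γ, fun n => τ * σ ^ n, ⟨hθc, hφc, hγc, ?_, ?_, ?_, fun x _ => hθmem x, ?_, hφmem,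
    ?_, ?_, ?_⟩⟩
  · intro n; rw [abs_mul, abs_pow, hτabs, hσabs]; simp
  · rw [hθ]
    have : σ * y a / 2 = 1 := by rw [hσ]; linarith
    simp [this]
  · rw [hθ]
    have : σ * y b / 2 = -1 := by rw [hσ, hyb]; linarith
    simp [this]
  · intro x _
    rw [hγ]
    exact ⟨Real.arcsin_nonneg.mpr (hγarg0 x), Real.arcsin_lt_pi_div_two.mpr (hγarg1 x)⟩
  · intro x hx h1 h2
    rw [hγ]
    refine Real.arcsin_pos.mpr (div_pos (mul_pos two_pos ?_) (hDpos x))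
    exact Real.sin_pos_of_pos_of_lt_pi (lt_of_le_of_ne (hθmem x).1 (Ne.symm h1))
      (lt_of_le_of_ne (hθmem x).2 h2)
  · intro x hx h
    rw [hγ, hφ]
    simp [hends x h]
  · intro n x hx
    have h1 := (hrel n x hx).1
    have h2 := hsinγ x
    have h3 : (σ ^ n) ^ 2 = 1 := by rw [← pow_mul, mul_comm, pow_mul, hσ2, one_pow]
    refine mul_left_cancel₀ (hDpos x).ne' ?_
    linear_combination u n x * h2 + 2 * τ * σ ^ n * h1
      - 2 * u n x * Real.sin (θ x) * τ ^ 2 * h3 - 2 * u n x * Real.sin (θ x) * hτ2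

theorem Phase.two_lt_abs {u : ℕ → ℝ → ℝ} {a b : ℝ} {θ φ γ : ℝ → ℝ} {s : ℕ → ℝ}
    (P : Phase u a b θ φ γ s) {n : ℕ} {x : ℝ} (hx : x ∈ Set.Icc a b) (hγ : 0 < γ x)
    (h : Real.sin (γ x) < |Real.cos (φ x + n * θ x)|) : 2 < |u n x| := by
  have hs : 0 < Real.sin (γ x) :=
    Real.sin_pos_of_pos_of_lt_pi hγ (by linarith [(P.memγ x hx).2, Real.pi_pos])
  have := congrArg abs (P.rel n x hx)
  rw [abs_mul, abs_mul, abs_mul, P.sign, abs_of_pos hs, abs_two] at this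
  nlinarith

theorem Phase.abs_le_two {u : ℕ → ℝ → ℝ} {a b : ℝ} {θ φ γ : ℝ → ℝ} {s : ℕ → ℝ}
    (P : Phase u a b θ φ γ s) {n : ℕ} {x : ℝ} (hx : x ∈ Set.Icc a b) (hγ : 0 < γ x)
    (h : |Real.cos (φ x + n * θ x)| ≤ Real.sin (γ x)) : |u n x| ≤ 2 := by
  have hs : 0 < Real.sin (γ x) :=
    Real.sin_pos_of_pos_of_lt_pi hγ (by linarith [(P.memγ x hx).2, Real.pi_pos])
  have := congrArg abs (P.rel n x hx)
  rw [abs_mul, abs_mul, abs_mul, P.sign, abs_of_pos hs, abs_two] at this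
  nlinarith

theorem abs_cos_add_nat_mul_pi (t : ℝ) (j : ℕ) : |Real.cos (t + j * Real.pi)| = |Real.cos t| := by
  rw [Real.cos_add_nat_mul_pi, abs_mul, abs_pow, abs_neg, abs_one, one_pow, one_mul]

/-- The interval `[c, d]` is the `j`-th interval on which the phase `φ + n θ` stays within distance
`γ` of `π / 2` modulo `π`. -/
structure Phase.Window (θ φ γ : ℝ → ℝ) (a b : ℝ) (n j : ℕ) (c d : ℝ) : Prop where
  left_lt : a < c
  lt : c < d
  lt_right : d < b
  eq_left : φ c + n * θ c + γ c = Real.pi / 2 + j * Real.pi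
  eq_right : φ d + n * θ d - γ d = Real.pi / 2 + j * Real.pi
  ge_of_gt : ∀ x, c < x → x ≤ b → Real.pi / 2 + j * Real.pi ≤ φ x + n * θ x + γ x
  le_of_mem : ∀ x ∈ Set.Icc c d, φ x + n * θ x - γ x ≤ Real.pi / 2 + j * Real.pi
  posθ_left : 0 < θ c ∧ θ c < Real.pi
  posθ_right : 0 < θ d ∧ θ d < Real.pi

/-- Monotonicity of the phase is not needed. The left endpoint `c` is the last point where `φ + nθ +
γ` is below `β = π/2 + jπ`, and `d` is the first point after `c` where `φ + nθ - γ` is above it. In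
between the phase is within `γ` of `β`, and just outside `|u n|` exceeds `2`. The range `1 ≤ j < n`
keeps `β` strictly between the phases at the two ends of the band. -/
theorem Phase.exists_window {u : ℕ → ℝ → ℝ} {a b : ℝ} (hab : a < b) {θ φ γ : ℝ → ℝ} {s : ℕ → ℝ}
    (P : Phase u a b θ φ γ s) {n j : ℕ} (hj : 1 ≤ j) (hjn : j < n) :
    ∃ c d, Phase.Window θ φ γ a b n j c d ∧ Crossing (u n) c d := by
  have hθc := P.contθ
  have hφc := P.contφ
  have hγc := P.contγ
  have hπ := Real.pi_pos
  have hj1 : (1 : ℝ) ≤ j := by exact_mod_cast hj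
  have hjn1 : (j : ℝ) + 1 ≤ n := by exact_mod_cast hjn
  obtain ⟨β, hβ⟩ : ∃ β : ℝ, β = Real.pi / 2 + j * Real.pi := ⟨_, rfl⟩
  have hβ0 : Real.pi / 2 < β := by rw [hβ]; nlinarith
  have hβ1 : β < Real.pi / 2 + n * Real.pi := by rw [hβ]; nlinarith
  have hda := P.degenerate a ⟨le_rfl, hab.le⟩ (Or.inl P.left)
  have hdb := P.degenerate b ⟨hab.le, le_rfl⟩ (Or.inr P.right)
  -- Where `θ` is `0` or `π` the window has width zero and the phase is `π/2` or `π/2 + nπ`, neither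
  -- equal to `β`; so the window avoids the points where the relation for `u n` is void.
  have hnd : ∀ x ∈ Set.Icc a b, (φ x + n * θ x + γ x ≥ β ∧ φ x + n * θ x - γ x ≤ β) →
      (0 < θ x ∧ θ x < Real.pi) := by
    intro x hx h
    constructor
    · refine lt_of_le_of_ne (P.memθ x hx).1 (fun h0 => ?_)
      have := P.degenerate x hx (Or.inl h0.symm)
      rw [this.1, this.2, ← h0] at h
      linarith [h.1]
    · refine lt_of_le_of_ne (P.memθ x hx).2 (fun h0 => ?_)
      have := P.degenerate x hx (Or.inr h0)
      rw [this.1, this.2, h0] at h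
      linarith [h.2]
  -- the last time the entry phase is below the threshold
  have hcont1 : Continuous fun x => φ x + n * θ x + γ x := by fun_prop
  have hcont2 : Continuous fun x => φ x + n * θ x - γ x := by fun_prop
  obtain ⟨S, hS⟩ : ∃ S : Set ℝ, S = {x | x ∈ Set.Icc a b ∧ φ x + n * θ x + γ x < β} := ⟨_, rfl⟩
  have haS : a ∈ S := by
    rw [hS]; refine ⟨⟨le_rfl, hab.le⟩, ?_⟩
    rw [hda.1, hda.2, P.left]; linarith
  have hSb : BddAbove S := ⟨b, fun x hx => by rw [hS] at hx; exact hx.1.2⟩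
  obtain ⟨c, hc⟩ : ∃ c, c = sSup S := ⟨_, rfl⟩
  have hac : a ≤ c := by rw [hc]; exact le_csSup hSb haS
  have hcb : c ≤ b := by rw [hc]; exact csSup_le ⟨a, haS⟩ (fun x hx => by rw [hS] at hx; exact hx.1.2)
  have hgt : ∀ x, c < x → x ≤ b → β ≤ φ x + n * θ x + γ x := by
    intro x hx hxb
    by_contra hlt
    have : x ∈ S := by rw [hS]; exact ⟨⟨hac.trans hx.le, hxb⟩, not_le.mp hlt⟩
    exact absurd (le_csSup hSb this) (by rw [← hc]; exact not_le.mpr hx)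
  have hacc : ∀ ε > 0, ∃ x ∈ S, c - ε < x := by
    intro ε hε
    obtain ⟨x, hxS, hx⟩ := exists_lt_of_lt_csSup ⟨a, haS⟩ (show c - ε < sSup S by rw [← hc]; linarith)
    exact ⟨x, hxS, hx⟩
  have hcle : φ c + n * θ c + γ c ≤ β := by
    by_contra hlt
    have hev := hcont1.continuousAt.eventually (lt_mem_nhds (not_le.mp hlt))
    obtain ⟨ε, hε, hball⟩ := Metric.eventually_nhds_iff.mp hev
    obtain ⟨x, hxS, hx⟩ := hacc ε hε
    have hxc : x ≤ c := by rw [hc]; exact le_csSup hSb hxS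
    have := hball (y := x) (by rw [Real.dist_eq, abs_lt]; constructor <;> linarith)
    rw [hS] at hxS
    exact absurd hxS.2 (not_lt.mpr this.le)
  have hcltb : c < b := by
    refine lt_of_le_of_ne hcb (fun h => ?_)
    rw [h, hdb.1, hdb.2, P.right] at hcle
    linarith
  have hceq : φ c + n * θ c + γ c = β := by
    refine le_antisymm hcle ?_
    by_contra hlt
    have hev := hcont1.continuousAt.eventually (gt_mem_nhds (not_le.mp hlt))
    obtain ⟨ε, hε, hball⟩ := Metric.eventually_nhds_iff.mp hev
    obtain ⟨x, hx1, hx2⟩ := exists_between (lt_min hcltb (show c < c + ε by linarith))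
    have := hball (y := x) (by
      rw [Real.dist_eq, abs_lt]; constructor <;> linarith [min_le_right b (c + ε)])
    exact absurd (hgt x hx1 (hx2.le.trans (min_le_left _ _))) (not_le.mpr this)
  have haltc : a < c := by
    refine lt_of_le_of_ne hac (fun h => ?_)
    rw [← h, hda.1, hda.2, P.left] at hceq
    linarith
  have hcI : c ∈ Set.Icc a b := ⟨hac, hcb⟩
  have hθcpos := hnd c hcI ⟨hceq.ge, by linarith [(P.memγ c hcI).1]⟩
  have hγcpos : 0 < γ c := P.pos c hcI hθcpos.1.ne' hθcpos.2.ne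
  -- the first time after `c` that the exit phase is above the threshold
  obtain ⟨T, hT⟩ : ∃ T : Set ℝ, T = {x | x ∈ Set.Icc c b ∧ β < φ x + n * θ x - γ x} := ⟨_, rfl⟩
  have hbT : b ∈ T := by
    rw [hT]; refine ⟨⟨hcb, le_rfl⟩, ?_⟩
    rw [hdb.1, hdb.2, P.right]; linarith
  have hTb : BddBelow T := ⟨c, fun x hx => by rw [hT] at hx; exact hx.1.1⟩
  obtain ⟨d, hd⟩ : ∃ d, d = sInf T := ⟨_, rfl⟩
  have hdb' : d ≤ b := by rw [hd]; exact csInf_le hTb hbT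
  have hcd : c ≤ d := by rw [hd]; exact le_csInf ⟨b, hbT⟩ (fun x hx => by rw [hT] at hx; exact hx.1.1)
  have hlt' : ∀ x, c ≤ x → x < d → φ x + n * θ x - γ x ≤ β := by
    intro x hx hxd
    by_contra hlt
    have : x ∈ T := by rw [hT]; exact ⟨⟨hx, hxd.le.trans hdb'⟩, not_le.mp hlt⟩
    exact absurd (csInf_le hTb this) (by rw [← hd]; exact not_le.mpr hxd)
  have hacc' : ∀ ε > 0, ∃ x ∈ T, x < d + ε := by
    intro ε hε
    obtain ⟨x, hxT, hx⟩ := exists_lt_of_csInf_lt ⟨b, hbT⟩ (show sInf T < d + ε by rw [← hd]; linarith)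
    exact ⟨x, hxT, hx⟩
  have hdge : β ≤ φ d + n * θ d - γ d := by
    by_contra hlt
    have hev := hcont2.continuousAt.eventually (gt_mem_nhds (not_le.mp hlt))
    obtain ⟨ε, hε, hball⟩ := Metric.eventually_nhds_iff.mp hev
    obtain ⟨x, hxT, hx⟩ := hacc' ε hε
    have hxd : d ≤ x := by rw [hd]; exact csInf_le hTb hxT
    have := hball (y := x) (by rw [Real.dist_eq, abs_lt]; constructor <;> linarith)
    rw [hT] at hxT
    exact absurd hxT.2 (not_lt.mpr this.le)
  have hcltd : c < d := by
    refine lt_of_le_of_ne hcd (fun h => ?_)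
    rw [← h] at hdge
    linarith
  have hdeq : φ d + n * θ d - γ d = β := by
    refine le_antisymm ?_ hdge
    by_contra hlt
    have hev := hcont2.continuousAt.eventually (lt_mem_nhds (not_le.mp hlt))
    obtain ⟨ε, hε, hball⟩ := Metric.eventually_nhds_iff.mp hev
    obtain ⟨x, hx1, hx2⟩ := exists_between (max_lt hcltd (show d - ε < d by linarith))
    have := hball (y := x) (by
      rw [Real.dist_eq, abs_lt]; constructor <;> linarith [le_max_right c (d - ε)])
    exact absurd (hlt' x ((le_max_left _ _).trans hx1.le) hx2) (not_le.mpr this)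
  have hdltb : d < b := by
    refine lt_of_le_of_ne hdb' (fun h => ?_)
    rw [h, hdb.1, hdb.2, P.right] at hdeq
    linarith
  have hdI : d ∈ Set.Icc a b := ⟨hac.trans hcd, hdb'⟩
  have hθdpos := hnd d hdI ⟨by linarith [(P.memγ d hdI).1], hdeq.le⟩
  have hγdpos : 0 < γ d := P.pos d hdI hθdpos.1.ne' hθdpos.2.ne
  have hle : ∀ x ∈ Set.Icc c d, φ x + n * θ x - γ x ≤ β := by
    intro x hx
    rcases eq_or_lt_of_le hx.2 with h | h
    · rw [h, hdeq]
    · exact hlt' x hx.1 h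
  have hge : ∀ x ∈ Set.Icc c d, β ≤ φ x + n * θ x + γ x := by
    intro x hx
    rcases eq_or_lt_of_le hx.1 with h | h
    · rw [← h, hceq]
    · exact hgt x h (hx.2.trans hdb')
  have hsinpos : ∀ x ∈ Set.Icc a b, 0 < γ x → 0 < Real.sin (γ x) := fun x hx h =>
    Real.sin_pos_of_pos_of_lt_pi h (by linarith [(P.memγ x hx).2])
  -- values at the endpoints
  have hcosc : Real.cos (φ c + n * θ c) = (-1) ^ j * Real.sin (γ c) := by
    rw [show φ c + n * θ c = (Real.pi / 2 - γ c) + j * Real.pi by linarith,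
      Real.cos_add_nat_mul_pi, Real.cos_pi_div_two_sub]
  have hcosd : Real.cos (φ d + n * θ d) = -((-1) ^ j * Real.sin (γ d)) := by
    rw [show φ d + n * θ d = (γ d + Real.pi / 2) + j * Real.pi by linarith,
      Real.cos_add_nat_mul_pi, Real.cos_add_pi_div_two]; ring
  have huc : u n c = 2 * s n * (-1) ^ j := by
    have := P.rel n c hcI
    rw [hcosc] at this
    refine mul_right_cancel₀ (hsinpos c hcI hγcpos).ne' ?_
    linear_combination this
  have hud : u n d = -(2 * s n * (-1) ^ j) := by
    have := P.rel n d hdI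
    rw [hcosd] at this
    refine mul_right_cancel₀ (hsinpos d hdI hγdpos).ne' ?_
    linear_combination this
  refine ⟨c, d, ⟨haltc, hcltd, hdltb, hβ ▸ hceq, hβ ▸ hdeq, hβ ▸ hgt, hβ ▸ hle, hθcpos, hθdpos⟩,
    hcltd, ?_, ?_, ?_, ?_, ?_⟩
  · intro x hx
    have hxI : x ∈ Set.Icc a b := ⟨hac.trans hx.1, hx.2.trans hdb'⟩
    have hθx := hnd x hxI ⟨hge x hx, hle x hx⟩
    have hγx := P.pos x hxI hθx.1.ne' hθx.2.ne
    refine P.abs_le_two hxI hγx ?_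
    have h1 := hge x hx
    have h2 := hle x hx
    have h3 := P.memγ x hxI
    rw [show φ x + n * θ x = (φ x + n * θ x - β + Real.pi / 2) + j * Real.pi by rw [hβ]; ring,
      abs_cos_add_nat_mul_pi, Real.cos_add_pi_div_two, abs_neg, abs_le, ← Real.sin_neg]
    constructor
    · exact Real.sin_le_sin_of_le_of_le_pi_div_two (by linarith) (by linarith) (by linarith)
    · exact Real.sin_le_sin_of_le_of_le_pi_div_two (by linarith) (by linarith) (by linarith)
  · rw [huc, abs_mul, abs_mul, P.sign, abs_pow, abs_neg, abs_one]; norm_num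
  · rw [huc, hud]
  · intro ε hε
    have hev : ∀ᶠ x in nhds c, 0 < γ x ∧ β - Real.pi / 2 < φ x + n * θ x :=
      (hγc.continuousAt.eventually (lt_mem_nhds hγcpos)).and
        ((show Continuous fun x => φ x + n * θ x by fun_prop).continuousAt.eventually
          (lt_mem_nhds (by linarith [(P.memγ c hcI).2])))
    obtain ⟨δ, hδ, hball⟩ := Metric.eventually_nhds_iff.mp hev
    obtain ⟨x, hxS, hx⟩ := hacc (min ε δ) (lt_min hε hδ)
    have hxc : x ≤ c := by rw [hc]; exact le_csSup hSb hxS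
    rw [hS] at hxS
    have hxc' : x < c := lt_of_le_of_ne hxc (fun h => by
      have := hxS.2; rw [h, hceq] at this; exact lt_irrefl _ this)
    have hx' := hball (y := x) (by
      rw [Real.dist_eq, abs_lt]; constructor <;> linarith [min_le_right ε δ])
    refine ⟨x, ⟨by linarith [min_le_left ε δ], hxc'⟩, P.two_lt_abs hxS.1 hx'.1 ?_⟩
    have h3 := P.memγ x hxS.1
    rw [show φ x + n * θ x = (φ x + n * θ x - β + Real.pi / 2) + j * Real.pi by rw [hβ]; ring,
      abs_cos_add_nat_mul_pi, Real.cos_add_pi_div_two, ← Real.sin_neg]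
    refine lt_of_lt_of_le ?_ (le_abs_self _)
    exact Real.sin_lt_sin_of_lt_of_le_pi_div_two (by linarith) (by linarith [hx'.2])
      (by linarith [hxS.2])
  · intro ε hε
    have hev : ∀ᶠ x in nhds d, 0 < γ x ∧ φ x + n * θ x < β + Real.pi / 2 :=
      (hγc.continuousAt.eventually (lt_mem_nhds hγdpos)).and
        ((show Continuous fun x => φ x + n * θ x by fun_prop).continuousAt.eventually
          (gt_mem_nhds (by linarith [(P.memγ d hdI).2])))
    obtain ⟨δ, hδ, hball⟩ := Metric.eventually_nhds_iff.mp hev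
    obtain ⟨x, hxT, hx⟩ := hacc' (min ε δ) (lt_min hε hδ)
    have hxd : d ≤ x := by rw [hd]; exact csInf_le hTb hxT
    rw [hT] at hxT
    have hxd' : d < x := lt_of_le_of_ne hxd (fun h => by
      have := hxT.2; rw [← h, hdeq] at this; exact lt_irrefl _ this)
    have hx' := hball (y := x) (by
      rw [Real.dist_eq, abs_lt]; constructor <;> linarith [min_le_right ε δ])
    have hxI : x ∈ Set.Icc a b := ⟨hac.trans hxT.1.1, hxT.1.2⟩
    refine ⟨x, ⟨hxd', by linarith [min_le_left ε δ]⟩, P.two_lt_abs hxI hx'.1 ?_⟩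
    have h3 := P.memγ x hxI
    rw [show φ x + n * θ x = (φ x + n * θ x - β + Real.pi / 2) + j * Real.pi by rw [hβ]; ring,
      abs_cos_add_nat_mul_pi, Real.cos_add_pi_div_two, abs_neg]
    refine lt_of_lt_of_le ?_ (le_abs_self _)
    exact Real.sin_lt_sin_of_lt_of_le_pi_div_two (by linarith) (by linarith [hx'.2])
      (by linarith [hxT.2])

/-- Inside a crossing of `y` on which `|u 0| ≤ 2`, the crossings of `u (p + 1)` and `u (p + 2)`
interlace. -/
theorem exists_interlacing_crossings {V : ℝ} (hV : 0 < V) {y : ℝ → ℝ} {u : ℕ → ℝ → ℝ} {a b : ℝ}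
    (hy : Continuous y) (hu0 : Continuous (u 0)) (hu1 : Continuous (u 1))
    (hrec : ∀ n x, u (n + 2) x = y x * u (n + 1) x - u n x)
    (hinv : ∀ x, u 0 x ^ 2 + u 1 x ^ 2 + y x ^ 2 - y x * u 0 x * u 1 x = 4 + V ^ 2)
    (hab : Crossing y a b) (h0 : ∀ x ∈ Set.Icc a b, |u 0 x| ≤ 2) (p : ℕ) :
    (∃ (J : Fin p → ℝ × ℝ) (K : Fin (p + 1) → ℝ × ℝ),
      (∀ j, Crossing (u (p + 1)) (J j).1 (J j).2 ∧ a < (J j).1 ∧ (J j).2 < b) ∧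
      (∀ j, Crossing (u (p + 2)) (K j).1 (K j).2 ∧ a < (K j).1 ∧ (K j).2 < b) ∧
      ∀ j : Fin p, ((K j.castSucc).1 < (J j).1 ∧ (K j.castSucc).2 < (J j).2) ∧
        ((J j).1 < (K j.succ).1 ∧ (J j).2 < (K j.succ).2)) := by
  obtain ⟨θ, φ, γ, s, P⟩ := exists_phase hV hab.lt.le hy hu0 hu1 hrec hinv hab.le hab.abs_left
    hab.opp h0
  have hJ : ∀ j : Fin p, ∃ e : ℝ × ℝ, Phase.Window θ φ γ a b (p + 1) (j + 1) e.1 e.2 ∧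
      Crossing (u (p + 1)) e.1 e.2 := fun j => by
    obtain ⟨c, d, h⟩ := P.exists_window hab.lt (n := p + 1) (j := j + 1) (by omega)
      (by have := j.2; omega)
    exact ⟨(c, d), h⟩
  have hK : ∀ j : Fin (p + 1), ∃ e : ℝ × ℝ, Phase.Window θ φ γ a b (p + 2) (j + 1) e.1 e.2 ∧
      Crossing (u (p + 2)) e.1 e.2 := fun j => by
    obtain ⟨c, d, h⟩ := P.exists_window hab.lt (n := p + 2) (j := j + 1) (by omega)
      (by have := j.2; omega)
    exact ⟨(c, d), h⟩
  choose J hJw hJc using hJ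
  choose K hKw hKc using hK
  refine ⟨J, K, fun j => ⟨hJc j, (hJw j).left_lt, (hJw j).lt_right⟩,
    fun j => ⟨hKc j, (hKw j).left_lt, (hKw j).lt_right⟩, fun j => ?_⟩
  have A := hJw j
  have B := hKw j.castSucc
  have C := hKw j.succ
  simp only [Fin.val_castSucc, Fin.val_succ] at B C
  obtain ⟨A1, A2, A3, A4, A5, A6, A7, A8, A9⟩ := A
  obtain ⟨B1, B2, B3, B4, B5, B6, B7, B8, B9⟩ := B
  obtain ⟨C1, C2, C3, C4, C5, C6, C7, C8, C9⟩ := C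
  push_cast at A4 A5 A6 A7 B4 B5 B6 B7 C4 C5 C6 C7
  -- The phases for `p + 2` and `p + 1` differ by `θ`, which lies in `(0, π)` at the endpoints
  -- concerned: the first is ahead, but by less than one period. Positivity compares windows of
  -- equal index, `θ < π` compares consecutive ones.
  have k1 : (K j.castSucc).1 < (J j).1 := by
    by_contra hcon
    rcases eq_or_lt_of_le (not_lt.mp hcon) with h | h
    · rw [← h] at B4; linarith
    · have := A6 _ h (by linarith); linarith
  have k2 : (J j).1 < (K j.succ).1 := by
    by_contra hcon
    rcases eq_or_lt_of_le (not_lt.mp hcon) with h | h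
    · rw [h] at C4; linarith
    · have := C6 _ h (by linarith); linarith
  refine ⟨⟨k1, ?_⟩, k2, ?_⟩
  · by_contra hcon
    have := B7 _ ⟨k1.le.trans A2.le, not_lt.mp hcon⟩
    linarith
  · by_contra hcon
    have := A7 _ ⟨k2.le.trans C2.le, not_lt.mp hcon⟩
    linarith

/-- The phase `φ + θ` of `u 1` runs from `π/2` to `3π/2`; where it equals `π` the cosine has modulus
`1 > sin γ`. -/
theorem exists_two_lt_abs {V : ℝ} (hV : 0 < V) {y : ℝ → ℝ} {u : ℕ → ℝ → ℝ} {a b : ℝ}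
    (hy : Continuous y) (hu0 : Continuous (u 0)) (hu1 : Continuous (u 1))
    (hrec : ∀ n x, u (n + 2) x = y x * u (n + 1) x - u n x)
    (hinv : ∀ x, u 0 x ^ 2 + u 1 x ^ 2 + y x ^ 2 - y x * u 0 x * u 1 x = 4 + V ^ 2)
    (hab : Crossing y a b) (h0 : ∀ x ∈ Set.Icc a b, |u 0 x| ≤ 2) :
    ∃ x ∈ Set.Icc a b, 2 < |u 1 x| := by
  obtain ⟨θ, φ, γ, s, P⟩ := exists_phase hV hab.lt.le hy hu0 hu1 hrec hinv hab.le hab.abs_left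
    hab.opp h0
  have hθc := P.contθ
  have hφc := P.contφ
  have hπ := Real.pi_pos
  have hda := P.degenerate a ⟨le_rfl, hab.lt.le⟩ (Or.inl P.left)
  have hdb := P.degenerate b ⟨hab.lt.le, le_rfl⟩ (Or.inr P.right)
  obtain ⟨x, hx, hxe⟩ := intermediate_value_Icc hab.lt.le
    (show Continuous fun x => φ x + θ x by fun_prop).continuousOn
    (show Real.pi ∈ Set.Icc (φ a + θ a) (φ b + θ b) by
      rw [hda.2, hdb.2, P.left, P.right]; constructor <;> linarith)
  simp only at hxe
  have hγ : 0 < γ x := by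
    refine P.pos x hx (fun h => ?_) (fun h => ?_)
    · rw [h] at hxe; linarith [(P.memφ x hx).2]
    · rw [h] at hxe; linarith [(P.memφ x hx).1]
  refine ⟨x, hx, P.two_lt_abs hx hγ ?_⟩
  rw [Nat.cast_one, one_mul, hxe, Real.cos_pi, abs_neg, abs_one]
  have := Real.sin_lt_sin_of_lt_of_le_pi_div_two (by linarith) le_rfl (P.memγ x hx).2
  rwa [Real.sin_pi_div_two] at this

/-! ### Crossings as connected components, and the degree bound -/

theorem Crossing.left_mem {u : ℝ → ℝ} {c d : ℝ} (h : Crossing u c d) : c ∈ Set.Icc c d :=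
  ⟨le_rfl, h.lt.le⟩

theorem Crossing.eq_of_mem {u : ℝ → ℝ} {c d c' d' x : ℝ} (h : Crossing u c d)
    (h' : Crossing u c' d') (hx : x ∈ Set.Icc c d) (hx' : x ∈ Set.Icc c' d') :
    c = c' ∧ d = d' := by
  have key1 : ∀ {c d c' d' : ℝ}, Crossing u c d → Crossing u c' d' → x ∈ Set.Icc c d →
      x ∈ Set.Icc c' d' → c' ≤ c := by
    intro c d c' d' h h' hx hx'
    by_contra hlt
    obtain ⟨z, hz, hz2⟩ := h'.accL (c' - c) (by linarith [not_le.mp hlt])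
    exact absurd (h.le z ⟨by linarith [hz.1], by linarith [hz.2, hx'.1, hx.2]⟩) (not_le.mpr hz2)
  have key2 : ∀ {c d c' d' : ℝ}, Crossing u c d → Crossing u c' d' → x ∈ Set.Icc c d →
      x ∈ Set.Icc c' d' → d ≤ d' := by
    intro c d c' d' h h' hx hx'
    by_contra hlt
    obtain ⟨z, hz, hz2⟩ := h'.accR (d - d') (by linarith [not_le.mp hlt])
    exact absurd (h.le z ⟨by linarith [hz.1, hx'.2, hx.1], by linarith [hz.2]⟩) (not_le.mpr hz2)
  exact ⟨le_antisymm (key1 h' h hx' hx) (key1 h h' hx hx'),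
    le_antisymm (key2 h h' hx hx') (key2 h' h hx' hx)⟩

theorem Crossing.connectedComponentIn_eq {u : ℝ → ℝ} {c d x : ℝ} (h : Crossing u c d)
    (hx : x ∈ Set.Icc c d) : connectedComponentIn {e | |u e| ≤ 2} x = Set.Icc c d := by
  have hsub : Set.Icc c d ⊆ {e | |u e| ≤ 2} := h.le
  refine Set.Subset.antisymm (fun z hz => ?_)
    (isPreconnected_Icc.subset_connectedComponentIn hx hsub)
  have hoc := (isPreconnected_connectedComponentIn (x := x) (F := {e | |u e| ≤ 2})).ordConnected
  have hcs := connectedComponentIn_subset {e | |u e| ≤ 2} x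
  have hx0 := mem_connectedComponentIn (hsub hx)
  constructor
  · by_contra hlt
    obtain ⟨w, hw, hw2⟩ := h.accL (c - z) (by linarith [not_le.mp hlt])
    have := hcs (hoc.out hz hx0 (⟨by linarith [hw.1], by linarith [hw.2, hx.1]⟩ : w ∈ Set.Icc z x))
    exact absurd this (not_le.mpr hw2)
  · by_contra hlt
    obtain ⟨w, hw, hw2⟩ := h.accR (z - d) (by linarith [not_le.mp hlt])
    have := hcs (hoc.out hx0 hz (⟨by linarith [hw.1, hx.2], by linarith [hw.2]⟩ : w ∈ Set.Icc x z))
    exact absurd this (not_le.mpr hw2)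

theorem Crossing.exists_eq {u : ℝ → ℝ} {c d v : ℝ} (hu : Continuous u) (h : Crossing u c d)
    (hv : |v| ≤ 2) : ∃ r ∈ Set.Icc c d, u r = v := by
  have hv' := abs_le.mp hv
  rcases le_total (u c) 0 with h0 | h0
  · have h1 : u c = -2 := by have := h.abs_left; rw [abs_of_nonpos h0] at this; linarith
    exact intermediate_value_Icc h.lt.le hu.continuousOn
      ⟨by linarith, by rw [h.opp, h1]; linarith⟩
  · have h1 : u c = 2 := by have := h.abs_left; rwa [abs_of_nonneg h0] at this
    exact intermediate_value_Icc' h.lt.le hu.continuousOn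
      ⟨by rw [h.opp, h1]; linarith, by linarith⟩

/-- The finset of chosen solutions of `P = v` in a finset of crossings of `P`. -/
theorem exists_roots_of_crossings {P : ℝ[X]} {S : Finset (ℝ × ℝ)}
    (hS : ∀ e ∈ S, Crossing (fun x => P.eval x) e.1 e.2) {v : ℝ} (hv : |v| ≤ 2) :
    ∃ R : Finset ℝ, R.card = S.card ∧
      ∀ r ∈ R, P.eval r = v ∧ ∃ e ∈ S, r ∈ Set.Icc e.1 e.2 := by
  classical
  have h : ∀ e : ℝ × ℝ, ∃ r, e ∈ S → r ∈ Set.Icc e.1 e.2 ∧ P.eval r = v := by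
    intro e
    by_cases he : e ∈ S
    · obtain ⟨r, hr, hrv⟩ := (hS e he).exists_eq P.continuous hv
      exact ⟨r, fun _ => ⟨hr, hrv⟩⟩
    · exact ⟨0, fun h => absurd h he⟩
  choose r hr using h
  refine ⟨S.image r, Finset.card_image_of_injOn ?_, ?_⟩
  · intro e he e' he' hee
    have h1 := (hr e he).1
    have h2 := (hr e' he').1
    rw [← hee] at h2
    have := (hS e he).eq_of_mem (hS e' he') h1 h2
    exact Prod.ext this.1 this.2
  · intro x hx
    obtain ⟨e, he, rfl⟩ := Finset.mem_image.mp hx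
    exact ⟨(hr e he).2, e, he, (hr e he).1⟩

theorem Crossing.sub_C_ne_zero {P : ℝ[X]} {c d : ℝ} (h : Crossing (fun x => P.eval x) c d) (v : ℝ) :
    P - C v ≠ 0 := by
  intro h0
  have hP : P = C v := sub_eq_zero.mp h0
  have h1 := h.opp
  have h2 := h.abs_left
  simp only [hP, eval_C] at h1 h2
  have : v = 0 := by linarith
  rw [this] at h2
  norm_num at h2

theorem card_le_of_eval_eq {P : ℝ[X]} {q : ℕ} (hP : P.natDegree ≤ q) {v : ℝ} (h0 : P - C v ≠ 0)
    {R : Finset ℝ} (hR : ∀ r ∈ R, P.eval r = v) : R.card ≤ q := by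
  have h1 : R.val ⊆ (P - C v).roots := by
    intro r hr
    rw [mem_roots h0, IsRoot, eval_sub, eval_C, hR r hr, sub_self]
  refine (card_le_degree_of_subset_roots h1).trans ?_
  rw [natDegree_sub_C]
  exact hP

theorem card_crossings_le {P : ℝ[X]} {q : ℕ} (hP : P.natDegree ≤ q) {S : Finset (ℝ × ℝ)}
    (hS : ∀ e ∈ S, Crossing (fun x => P.eval x) e.1 e.2) : S.card ≤ q := by
  rcases S.eq_empty_or_nonempty with h | ⟨e, he⟩
  · simp [h]
  · obtain ⟨R, hR, hRv⟩ := exists_roots_of_crossings hS (v := 0) (by simp)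
    rw [← hR]
    exact card_le_of_eval_eq hP ((hS e he).sub_C_ne_zero 0) (fun r hr => (hRv r hr).1)

/-- With `q` crossings, each already containing a solution of `P = P(x)`, a point `x` outside all of
them would be one root too many. -/
theorem exists_mem_crossing {P : ℝ[X]} {q : ℕ} (hq : 0 < q) (hP : P.natDegree ≤ q)
    {S : Finset (ℝ × ℝ)} (hS : ∀ e ∈ S, Crossing (fun x => P.eval x) e.1 e.2) (hcard : q ≤ S.card)
    {x : ℝ} (hx : |P.eval x| ≤ 2) : ∃ e ∈ S, x ∈ Set.Icc e.1 e.2 := by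
  classical
  by_contra hcon
  obtain ⟨e, he⟩ := Finset.card_pos.mp (hq.trans_le hcard)
  obtain ⟨R, hR, hRv⟩ := exists_roots_of_crossings hS hx
  have hxR : x ∉ R := fun h => hcon (hRv x h).2
  have := card_le_of_eval_eq hP ((hS e he).sub_C_ne_zero (P.eval x)) (R := insert x R) (by
    intro r hr
    rcases Finset.mem_insert.mp hr with h | h
    · rw [h]
    · exact (hRv r h).1)
  rw [Finset.card_insert_of_notMem hxR] at this
  omega

theorem finite_crossings (P : ℝ[X]) :
    {e : ℝ × ℝ | Crossing (fun x => P.eval x) e.1 e.2}.Finite := by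
  by_contra hinf
  obtain ⟨S, hS, hcard⟩ := Set.Infinite.exists_subset_card_eq hinf (P.natDegree + 1)
  have := card_crossings_le (P := P) le_rfl (S := S) (fun e he => hS he)
  omega

/-! ### Trace polynomials and their invariant -/

/-- The sequence `u 0 = x`, `u 1 = z`, `u (n + 2) = y * u (n + 1) - u n`. -/
def chain {R : Type*} [CommRing R] (x y z : R) : ℕ → R
  | 0 => x
  | 1 => z
  | n + 2 => y * chain x y z (n + 1) - chain x y z n

theorem map_chain {R S : Type*} [CommRing R] [CommRing S] (f : R →+* S) (x y z : R) (n : ℕ) :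
    f (chain x y z n) = chain (f x) (f y) (f z) n := by
  have : f (chain x y z n) = chain (f x) (f y) (f z) n ∧
      f (chain x y z (n + 1)) = chain (f x) (f y) (f z) (n + 1) := by
    induction n with
    | zero => exact ⟨rfl, rfl⟩
    | succ n ih => exact ⟨ih.2, by simp only [chain, map_sub, map_mul, ih.1, ih.2]⟩
  exact this.1

/-- The form is quadratic in its first entry, and by Vieta `u n` and `u (n + 2) = y * u (n + 1) - u
n` are the two roots giving the same value. -/
theorem chain_invariant {R : Type*} [CommRing R] (x y z : R) (n : ℕ) :
    chain x y z n ^ 2 + chain x y z (n + 1) ^ 2 + y ^ 2 - y * chain x y z n * chain x y z (n + 1)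
      = x ^ 2 + z ^ 2 + y ^ 2 - y * x * z := by
  induction n with
  | zero => rfl
  | succ n ih => rw [← ih]; simp only [chain]; ring

/-- The polynomials `(t_{k-1}, t_k, tr (M_{k-1} M_k))` in the energy. -/
def traces (V : ℝ) (a : ℕ → ℕ) : ℕ → ℝ[X] × ℝ[X] × ℝ[X]
  | 0 => (2, X, X - C V)
  | k + 1 =>
    ((traces V a k).2.1,
      chain (traces V a k).1 (traces V a k).2.1 (traces V a k).2.2 (a (k + 1)),
      chain (traces V a k).1 (traces V a k).2.1 (traces V a k).2.2 (a (k + 1) + 1))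

/-- The trace `t_{k-1}` as a function of the energy. -/
def trPrev (V : ℝ) (a : ℕ → ℕ) (k : ℕ) (e : ℝ) : ℝ := (traces V a k).1.eval e

/-- The trace `t_k` as a function of the energy. -/
def tr (V : ℝ) (a : ℕ → ℕ) (k : ℕ) (e : ℝ) : ℝ := (traces V a k).2.1.eval e

/-- The trace of `M_{k-1} M_k` as a function of the energy. -/
def trMul (V : ℝ) (a : ℕ → ℕ) (k : ℕ) (e : ℝ) : ℝ := (traces V a k).2.2.eval e

/-- The trace of `M_{k-1} M_k ^ n` as a function of the energy. -/
def trChain (V : ℝ) (a : ℕ → ℕ) (k n : ℕ) (e : ℝ) : ℝ :=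
  chain (trPrev V a k e) (tr V a k e) (trMul V a k e) n

/-- The denominators of the convergents, shifted by one: `convDen a (k + 1) = q_k`. -/
def convDen (a : ℕ → ℕ) : ℕ → ℕ
  | 0 => 0
  | 1 => 1
  | k + 2 => a (k + 1) * convDen a (k + 1) + convDen a k

section

variable {V : ℝ} {a : ℕ → ℕ}

theorem trPrev_succ (k : ℕ) : trPrev V a (k + 1) = tr V a k := rfl

theorem tr_succ (k : ℕ) (e : ℝ) : tr V a (k + 1) e = trChain V a k (a (k + 1)) e :=
  map_chain (evalRingHom e) _ _ _ _

theorem trMul_succ (k : ℕ) (e : ℝ) : trMul V a (k + 1) e = trChain V a k (a (k + 1) + 1) e :=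
  map_chain (evalRingHom e) _ _ _ _

/-- The constant is the value at the initial triple `(2, E, E - V)`; passing to the next level moves
along the chain. -/
theorem traces_invariant (k : ℕ) (e : ℝ) :
    trPrev V a k e ^ 2 + trMul V a k e ^ 2 + tr V a k e ^ 2
      - tr V a k e * trPrev V a k e * trMul V a k e = 4 + V ^ 2 := by
  induction k with
  | zero => simp [trPrev, tr, trMul, traces]; ring
  | succ k ih =>
    rw [trPrev_succ, tr_succ, trMul_succ, trChain, trChain]
    linear_combination ih + chain_invariant (trPrev V a k e) (tr V a k e) (trMul V a k e) (a (k + 1))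

theorem continuous_trPrev (k : ℕ) : Continuous (trPrev V a k) := Polynomial.continuous _

theorem continuous_tr (k : ℕ) : Continuous (tr V a k) := Polynomial.continuous _

theorem continuous_trMul (k : ℕ) : Continuous (trMul V a k) := Polynomial.continuous _

theorem continuous_trChain (k n : ℕ) : Continuous (trChain V a k n) := by
  have : trChain V a k n = fun e =>
      (chain (traces V a k).1 (traces V a k).2.1 (traces V a k).2.2 n).eval e := by
    funext e
    exact (map_chain (evalRingHom e) _ _ _ _).symm
  rw [this]
  exact Polynomial.continuous _

theorem natDegree_chain_le {x y z : ℝ[X]} {r q : ℕ} (hx : x.natDegree ≤ r) (hy : y.natDegree ≤ q)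
    (hz : z.natDegree ≤ r + q) (n : ℕ) : (chain x y z n).natDegree ≤ r + n * q := by
  have : (chain x y z n).natDegree ≤ r + n * q ∧
      (chain x y z (n + 1)).natDegree ≤ r + (n + 1) * q := by
    induction n with
    | zero => simpa [chain] using ⟨hx, hz⟩
    | succ n ih =>
      refine ⟨ih.2, ?_⟩
      simp only [chain]
      refine (natDegree_sub_le _ _).trans (max_le ?_ ?_)
      · refine natDegree_mul_le.trans ((add_le_add hy ih.2).trans (le_of_eq ?_))
        ring
      · refine ih.1.trans ?_
        gcongr
        omega
  exact this.1

theorem natDegree_traces_le (k : ℕ) : (traces V a k).1.natDegree ≤ convDen a k ∧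
    (traces V a k).2.1.natDegree ≤ convDen a (k + 1) ∧
    (traces V a k).2.2.natDegree ≤ convDen a k + convDen a (k + 1) := by
  induction k with
  | zero =>
    refine ⟨?_, ?_, ?_⟩
    · exact (natDegree_ofNat 2).le
    · exact natDegree_X_le
    · exact (natDegree_X_sub_C_le _)
  | succ k ih =>
    obtain ⟨h1, h2, h3⟩ := ih
    refine ⟨h2, ?_, ?_⟩
    · refine (natDegree_chain_le h1 h2 h3 _).trans (le_of_eq ?_)
      simp only [convDen]; ring
    · refine (natDegree_chain_le h1 h2 h3 _).trans (le_of_eq ?_)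
      simp only [convDen]; ring

/-! ### Crossings of types A and B and their descendants -/

/-- A crossing of `t_k` on which `|t_{k-1}| ≤ 2`, strictly inside a crossing of `t_{k-1}`. -/
structure CrossingA (V : ℝ) (a : ℕ → ℕ) (k : ℕ) (e : ℝ × ℝ) : Prop where
  crossing : Crossing (tr V a k) e.1 e.2
  le : ∀ x ∈ Set.Icc e.1 e.2, |trPrev V a k x| ≤ 2
  parent : ∀ j, k = j + 1 → ∃ f : ℝ × ℝ, Crossing (tr V a j) f.1 f.2 ∧ f.1 < e.1 ∧ e.2 < f.2

/-- A crossing of `t_k` on which `|tr (M_{k-1} M_k⁻¹)| ≤ 2` and `|t_{k-1}| ≤ 2` fails somewhere,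
strictly inside a crossing of `t_{k-2}`. -/
structure CrossingB (V : ℝ) (a : ℕ → ℕ) (k : ℕ) (e : ℝ × ℝ) : Prop where
  crossing : Crossing (tr V a k) e.1 e.2
  le : ∀ x ∈ Set.Icc e.1 e.2, |tr V a k x * trPrev V a k x - trMul V a k x| ≤ 2
  two_lt : ∃ x ∈ Set.Icc e.1 e.2, 2 < |trPrev V a k x|
  parent : ∀ j, k = j + 2 → ∃ f : ℝ × ℝ, Crossing (tr V a j) f.1 f.2 ∧ f.1 < e.1 ∧ e.2 < f.2

/-- A crossing of `tr (M_{k-1} M_k)` on which `|t_{k-1}| ≤ 2` contains, for each `n ≥ 1`, a crossing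
of `tr (M_{k-1} M_k ^ n)` on which `|tr (M_{k-1} M_k ^ (n - 1))| ≤ 2`. -/
theorem exists_nested_crossing (hV : 0 < V) {k : ℕ} {e : ℝ × ℝ}
    (he : Crossing (trMul V a k) e.1 e.2) (hle : ∀ x ∈ Set.Icc e.1 e.2, |trPrev V a k x| ≤ 2)
    (n : ℕ) : ∃ f : ℝ × ℝ, Crossing (trChain V a k (n + 1)) f.1 f.2 ∧
      (∀ x ∈ Set.Icc f.1 f.2, |trChain V a k n x| ≤ 2) ∧
      (∃ x ∈ Set.Icc f.1 f.2, 2 < |tr V a k x|) ∧ e.1 ≤ f.1 ∧ f.2 ≤ e.2 := by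
  have hinv : ∀ n x, trChain V a k n x ^ 2 + tr V a k x ^ 2 + trChain V a k (n + 1) x ^ 2
      - trChain V a k (n + 1) x * trChain V a k n x * tr V a k x = 4 + V ^ 2 := by
    intro n x
    rw [trChain, trChain]
    linear_combination traces_invariant (V := V) (a := a) k x +
      chain_invariant (trPrev V a k x) (tr V a k x) (trMul V a k x) n
  -- The roles rotate: `tr (M_{k-1} M_k ^ (n + 1))` is now the band function, and the next entry of
  -- its own chain is `t_k`.
  have key : ∀ n, ∀ f : ℝ × ℝ, Crossing (trChain V a k (n + 1)) f.1 f.2 →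
      (∀ x ∈ Set.Icc f.1 f.2, |trChain V a k n x| ≤ 2) →
      ∃ x ∈ Set.Icc f.1 f.2, 2 < |tr V a k x| := fun n f hf hfle =>
    exists_two_lt_abs hV (y := trChain V a k (n + 1))
      (u := fun m x => chain (trChain V a k n x) (trChain V a k (n + 1) x) (tr V a k x) m)
      (continuous_trChain _ _) (continuous_trChain _ _) (continuous_tr _) (fun _ _ => rfl)
      (hinv n) hf hfle
  induction n with
  | zero => exact ⟨e, he, hle, key 0 e he hle, le_rfl, le_rfl⟩
  | succ n ih =>
    obtain ⟨f, hf, hfle, -, hef1, hef2⟩ := ih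
    -- With `p = 0` there is no `J` and a single `K`; its function `u 2` is `tr (M_{k-1} M_k ^ (n +
    -- 2))`.
    obtain ⟨_, K, -, hK, -⟩ := exists_interlacing_crossings hV (y := trChain V a k (n + 1))
      (u := fun m x => chain (trChain V a k n x) (trChain V a k (n + 1) x) (tr V a k x) m)
      (continuous_trChain _ _) (continuous_trChain _ _) (continuous_tr _) (fun _ _ => rfl)
      (hinv n) hf hfle 0
    obtain ⟨h1, h2, h3⟩ := hK 0
    have h1' : Crossing (trChain V a k (n + 1 + 1)) (K 0).1 (K 0).2 := by
      convert h1 using 2 with x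
      simp only [trChain, chain]
      ring
    have h4 : ∀ x ∈ Set.Icc (K 0).1 (K 0).2, |trChain V a k (n + 1) x| ≤ 2 := fun x hx =>
      hf.le x ⟨h2.le.trans hx.1, hx.2.trans h3.le⟩
    exact ⟨K 0, h1', h4, key _ _ h1' h4, hef1.trans h2.le, h3.le.trans hef2⟩

/-- For `n = a (k + 1) - 1` the nested crossing belongs to `t_{k+1}`, and `tr (M_k M_{k+1}⁻¹)`
equals the trace of `M_{k-1} M_k ^ n`, which is bounded by `2` there. -/
theorem exists_crossingB (hV : 0 < V) {k : ℕ} (ha : 1 ≤ a (k + 1)) {e : ℝ × ℝ}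
    (he : Crossing (trMul V a k) e.1 e.2) (hle : ∀ x ∈ Set.Icc e.1 e.2, |trPrev V a k x| ≤ 2)
    (hpar : ∀ j, k = j + 1 → ∃ f : ℝ × ℝ, Crossing (tr V a j) f.1 f.2 ∧ f.1 < e.1 ∧ e.2 < f.2) :
    ∃ f : ℝ × ℝ, CrossingB V a (k + 1) f ∧ e.1 ≤ f.1 ∧ f.2 ≤ e.2 := by
  obtain ⟨n, hn⟩ : ∃ n, a (k + 1) = n + 1 := ⟨a (k + 1) - 1, by omega⟩
  obtain ⟨f, hf, hfle, hf2, hef1, hef2⟩ := exists_nested_crossing hV he hle n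
  refine ⟨f, ⟨?_, ?_, ?_, ?_⟩, hef1, hef2⟩
  · convert hf using 1
    funext x
    rw [tr_succ, hn]
  · intro x hx
    convert hfle x hx using 2
    rw [tr_succ, trMul_succ, trPrev_succ, hn]
    simp only [trChain, chain]
    ring
  · exact hf2
  · intro j hj
    obtain ⟨g, hg, hg1, hg2⟩ := hpar j (by omega)
    exact ⟨g, hg, hg1.trans_le hef1, hef2.trans_lt hg2⟩

/-- The crossings generated inside the crossing `e` of `t_k`. -/
structure Children (V : ℝ) (a : ℕ → ℕ) (k : ℕ) (e : ℝ × ℝ) (p : ℕ) (J : Fin p → ℝ × ℝ)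
    (K : Fin (p + 1) → ℝ × ℝ) : Prop where
  typeA : ∀ j, CrossingA V a (k + 1) (J j) ∧ e.1 < (J j).1 ∧ (J j).2 < e.2
  typeB : ∀ j, CrossingB V a (k + 2) (K j) ∧ e.1 < (K j).1 ∧ (K j).2 < e.2
  interlace : ∀ j : Fin p, ((K j.castSucc).1 < (J j).1 ∧ (K j.castSucc).2 < (J j).2) ∧
    ((J j).1 < (K j.succ).1 ∧ (J j).2 < (K j.succ).2)

/-- Common core of the two types, which differ only in the starting point of `u`. Each interval for
`tr (M_k M_{k+1})` is shrunk to a crossing of `t_{k+2}` inside it. -/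
theorem exists_children (hV : 0 < V) {k : ℕ} (ha : 1 ≤ a (k + 2)) {e : ℝ × ℝ}
    (he : Crossing (tr V a k) e.1 e.2) {u : ℕ → ℝ → ℝ} {p : ℕ}
    (hu0 : Continuous (u 0)) (hu1 : Continuous (u 1))
    (hrec : ∀ n x, u (n + 2) x = tr V a k x * u (n + 1) x - u n x)
    (hinv : ∀ x, u 0 x ^ 2 + u 1 x ^ 2 + tr V a k x ^ 2 - tr V a k x * u 0 x * u 1 x = 4 + V ^ 2)
    (h0 : ∀ x ∈ Set.Icc e.1 e.2, |u 0 x| ≤ 2)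
    (hp1 : u (p + 1) = tr V a (k + 1)) (hp2 : u (p + 2) = trMul V a (k + 1)) :
    ∃ J K, Children V a k e p J K := by
  obtain ⟨J, K, hJ, hK, hJK⟩ := exists_interlacing_crossings hV (continuous_tr k) hu0 hu1 hrec hinv
    he h0 p
  rw [hp1] at hJ
  rw [hp2] at hK
  have hex : ∀ j, ∃ f : ℝ × ℝ, CrossingB V a (k + 2) f ∧ (K j).1 ≤ f.1 ∧ f.2 ≤ (K j).2 := by
    intro j
    obtain ⟨h1, h2, h3⟩ := hK j
    refine exists_crossingB hV ha h1 (fun x hx => ?_) (fun i hi => ?_)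
    · exact he.le x ⟨h2.le.trans hx.1, hx.2.trans h3.le⟩
    · obtain rfl : k = i := by omega
      exact ⟨e, he, h2, h3⟩
  choose L hL hL1 hL2 using hex
  refine ⟨J, L, fun j => ?_, fun j => ?_, fun j => ?_⟩
  · obtain ⟨h1, h2, h3⟩ := hJ j
    refine ⟨⟨h1, fun x hx => he.le x ⟨h2.le.trans hx.1, hx.2.trans h3.le⟩, fun i hi => ?_⟩, h2, h3⟩
    obtain rfl : k = i := by omega
    exact ⟨e, he, h2, h3⟩
  · obtain ⟨h1, h2, h3⟩ := hK j
    exact ⟨hL j, h2.trans_le (hL1 j), (hL2 j).trans_lt h3⟩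
  · obtain ⟨⟨h1, h2⟩, h3, h4⟩ := hJK j
    refine ⟨⟨?_, (hL2 _).trans_lt h2⟩, h3.trans_le (hL1 _), ?_⟩
    -- Shrinking could break the order of the left endpoints only if the smaller interval fell
    -- inside `J j`, where `|t_{k+1}| ≤ 2`; type B forbids this. The right endpoints on the other
    -- side are treated symmetrically.
    · by_contra hcon
      obtain ⟨x, hx, hx2⟩ := (hL j.castSucc).two_lt
      exact absurd ((hJ j).1.le x ⟨(not_lt.mp hcon).trans hx.1,
        hx.2.trans ((hL2 _).trans h2.le)⟩) (not_le.mpr hx2)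
    · by_contra hcon
      obtain ⟨x, hx, hx2⟩ := (hL j.succ).two_lt
      exact absurd ((hJ j).1.le x ⟨h3.le.trans ((hL1 _).trans hx.1),
        hx.2.trans (not_lt.mp hcon)⟩) (not_le.mpr hx2)

theorem exists_children_of_abs_trPrev_le (hV : 0 < V) {k : ℕ} (ha1 : 1 ≤ a (k + 1))
    (ha : 1 ≤ a (k + 2)) {e : ℝ × ℝ} (he : Crossing (tr V a k) e.1 e.2)
    (h0 : ∀ x ∈ Set.Icc e.1 e.2, |trPrev V a k x| ≤ 2) :
    ∃ J K, Children V a k e (a (k + 1) - 1) J K := by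
  have h1 : a (k + 1) - 1 + 1 = a (k + 1) := by omega
  have h2 : a (k + 1) - 1 + 2 = a (k + 1) + 1 := by omega
  refine exists_children hV ha he (u := trChain V a k) (continuous_trPrev k) (continuous_trMul k)
    (fun _ _ => rfl) (traces_invariant k) h0 ?_ ?_
  · funext x; rw [h1, tr_succ]
  · funext x; rw [h2, trMul_succ]

/-- The chain is prolonged backwards to `tr (M_{k-1} M_k⁻¹)`, so every index shifts by one. This
accounts for the extra band compared with type A. -/
theorem CrossingB.exists_children (hV : 0 < V) {k : ℕ} (ha : 1 ≤ a (k + 2)) {e : ℝ × ℝ}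
    (he : CrossingB V a k e) : ∃ J K, Children V a k e (a (k + 1)) J K := by
  have hch : ∀ n x, chain (tr V a k x * trPrev V a k x - trMul V a k x) (tr V a k x)
      (trPrev V a k x) (n + 1) = trChain V a k n x := by
    intro n x
    have : chain (tr V a k x * trPrev V a k x - trMul V a k x) (tr V a k x)
        (trPrev V a k x) (n + 1) = trChain V a k n x ∧
        chain (tr V a k x * trPrev V a k x - trMul V a k x) (tr V a k x)
        (trPrev V a k x) (n + 2) = trChain V a k (n + 1) x := by
      induction n with
      | zero => refine ⟨rfl, ?_⟩; simp only [chain, trChain]; ring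
      | succ n ih =>
        refine ⟨ih.2, ?_⟩
        rw [chain, ih.1, ih.2]
        rfl
    exact this.1
  refine Sturmian.exists_children hV ha he.crossing
    (u := fun n x => chain (tr V a k x * trPrev V a k x - trMul V a k x) (tr V a k x)
      (trPrev V a k x) n) ?_ (continuous_trPrev k) (fun _ _ => rfl) ?_ he.le ?_ ?_
  · exact ((continuous_tr k).mul (continuous_trPrev k)).sub (continuous_trMul k)
  · intro x
    rw [← traces_invariant (V := V) (a := a) k x]
    simp only [chain]
    ring
  · funext x; rw [hch, tr_succ]
  · funext x; rw [hch, trMul_succ]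

/-! ### Counting bands against the degree -/

theorem sum_le_card_of_disjoint {ι β : Type*} (s : Finset ι) (T : Finset β)
    (f : ι → ℕ) (R : ι → β → Prop) (h : ∀ i ∈ s, ∃ F ⊆ T, f i ≤ F.card ∧ ∀ x ∈ F, R i x)
    (hR : ∀ i ∈ s, ∀ j ∈ s, ∀ x, R i x → R j x → i = j) : ∑ i ∈ s, f i ≤ T.card := by
  classical
  have h' : ∀ i, ∃ F : Finset β, i ∈ s → F ⊆ T ∧ f i ≤ F.card ∧ ∀ x ∈ F, R i x := by
    intro i
    by_cases hi : i ∈ s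
    · obtain ⟨F, hF⟩ := h i hi
      exact ⟨F, fun _ => hF⟩
    · exact ⟨∅, fun h => absurd h hi⟩
  choose F hF using h'
  calc ∑ i ∈ s, f i ≤ ∑ i ∈ s, (F i).card := Finset.sum_le_sum fun i hi => (hF i hi).2.1
    _ = (s.biUnion F).card := by
        rw [Finset.card_biUnion]
        intro i hi j hj hij
        rw [Function.onFun, Finset.disjoint_left]
        intro x hx hx'
        exact hij (hR i hi j hj x ((hF i hi).2.2 x hx) ((hF j hj).2.2 x hx'))
    _ ≤ T.card := Finset.card_le_card (Finset.biUnion_subset.mpr fun i hi => (hF i hi).1)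

theorem Children.strictMono_typeB {k : ℕ} {e : ℝ × ℝ} {p : ℕ} {J : Fin p → ℝ × ℝ}
    {K : Fin (p + 1) → ℝ × ℝ} (h : Children V a k e p J K) : StrictMono fun j => (K j).1 :=
  Fin.strictMono_iff_lt_succ.mpr fun j => (h.interlace j).1.1.trans (h.interlace j).2.1

theorem Children.strictMono_typeA {k : ℕ} {e : ℝ × ℝ} {p : ℕ} {J : Fin p → ℝ × ℝ}
    {K : Fin (p + 1) → ℝ × ℝ} (h : Children V a k e p J K) : StrictMono fun j => (J j).1 := by
  intro i j hij
  refine ((h.interlace i).2.1.trans_le (h.strictMono_typeB.monotone ?_)).trans (h.interlace j).1.1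
  exact Fin.succ_le_castSucc_iff.mpr hij

theorem finite_crossingA (k : ℕ) : {e | CrossingA V a k e}.Finite :=
  (finite_crossings (traces V a k).2.1).subset fun _ h => h.crossing

theorem finite_crossingB (k : ℕ) : {e | CrossingB V a k e}.Finite :=
  (finite_crossings (traces V a k).2.1).subset fun _ h => h.crossing

/-- The finset of crossings of type A. -/
def finsetA (V : ℝ) (a : ℕ → ℕ) (k : ℕ) : Finset (ℝ × ℝ) :=
  (finite_crossingA (V := V) (a := a) k).toFinset

/-- The finset of crossings of type B. -/
def finsetB (V : ℝ) (a : ℕ → ℕ) (k : ℕ) : Finset (ℝ × ℝ) :=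
  (finite_crossingB (V := V) (a := a) k).toFinset

theorem mem_finsetA {k : ℕ} {e : ℝ × ℝ} : e ∈ finsetA V a k ↔ CrossingA V a k e := by
  simp [finsetA]

theorem mem_finsetB {k : ℕ} {e : ℝ × ℝ} : e ∈ finsetB V a k ↔ CrossingB V a k e := by
  simp [finsetB]

theorem disjoint_finsetA_finsetB (k : ℕ) : Disjoint (finsetA V a k) (finsetB V a k) := by
  rw [Finset.disjoint_left]
  intro e hA hB
  obtain ⟨x, hx, hx2⟩ := (mem_finsetB.mp hB).two_lt
  exact absurd ((mem_finsetA.mp hA).le x hx) (not_le.mpr hx2)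

open Classical in
theorem crossing_of_mem_union {k : ℕ} {e : ℝ × ℝ} (h : e ∈ finsetA V a k ∪ finsetB V a k) :
    Crossing (tr V a k) e.1 e.2 := by
  rcases Finset.mem_union.mp h with h | h
  · exact (mem_finsetA.mp h).crossing
  · exact (mem_finsetB.mp h).crossing

theorem card_add_card_le (k : ℕ) :
    (finsetA V a k).card + (finsetB V a k).card ≤ convDen a (k + 1) := by
  classical
  rw [← Finset.card_union_of_disjoint (disjoint_finsetA_finsetB k)]
  exact card_crossings_le (natDegree_traces_le k).2.1 (fun e he => crossing_of_mem_union he)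

/-- Children of different crossings are different, since the left endpoint of a child determines the
parent: two crossings of `t_k` with a common point coincide. -/
theorem card_children_le (hV : 0 < V) (ha : ∀ k, 1 ≤ a (k + 1)) (k : ℕ) :
    (a (k + 1) - 1) * (finsetA V a k).card + a (k + 1) * (finsetB V a k).card
      ≤ (finsetA V a (k + 1)).card ∧
    a (k + 1) * (finsetA V a k).card + (a (k + 1) + 1) * (finsetB V a k).card
      ≤ (finsetB V a (k + 2)).card := by
  classical
  obtain ⟨f, hf⟩ : ∃ f : ℝ × ℝ → ℕ, f = fun e => if e ∈ finsetA V a k then a (k + 1) - 1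
    else a (k + 1) := ⟨_, rfl⟩
  have hfA : ∀ e ∈ finsetA V a k, f e = a (k + 1) - 1 := fun e he => by rw [hf]; exact if_pos he
  have hfB : ∀ e ∈ finsetB V a k, f e = a (k + 1) := fun e he => by
    rw [hf]; exact if_neg fun h => Finset.disjoint_left.mp (disjoint_finsetA_finsetB k) h he
  have hch : ∀ e ∈ finsetA V a k ∪ finsetB V a k, ∃ J K, Children V a k e (f e) J K := by
    intro e he
    rcases Finset.mem_union.mp he with h | h
    · rw [hfA e h]
      exact exists_children_of_abs_trPrev_le hV (ha k) (ha (k + 1)) (mem_finsetA.mp h).crossing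
        (mem_finsetA.mp h).le
    · rw [hfB e h]
      exact (mem_finsetB.mp h).exists_children hV (ha (k + 1))
  have hR : ∀ i ∈ finsetA V a k ∪ finsetB V a k, ∀ j ∈ finsetA V a k ∪ finsetB V a k,
      ∀ x : ℝ × ℝ, (i.1 < x.1 ∧ x.1 < i.2) → (j.1 < x.1 ∧ x.1 < j.2) → i = j := by
    intro i hi j hj x h1 h2
    have := (crossing_of_mem_union hi).eq_of_mem (crossing_of_mem_union hj)
      ⟨h1.1.le, h1.2.le⟩ ⟨h2.1.le, h2.2.le⟩
    exact Prod.ext this.1 this.2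
  have hsum : ∀ g : ℕ → ℕ, ∑ e ∈ finsetA V a k ∪ finsetB V a k, g (f e)
      = g (a (k + 1) - 1) * (finsetA V a k).card + g (a (k + 1)) * (finsetB V a k).card := by
    intro g
    rw [Finset.sum_union (disjoint_finsetA_finsetB k),
      Finset.sum_congr rfl (fun e he => by rw [hfA e he]),
      Finset.sum_congr (s₁ := finsetB V a k) rfl (fun e he => by rw [hfB e he]),
      Finset.sum_const, Finset.sum_const, smul_eq_mul, smul_eq_mul, mul_comm,
      mul_comm (finsetB V a k).card]
  constructor
  · rw [← hsum (fun n => n)]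
    refine sum_le_card_of_disjoint _ _ _ (fun i x => i.1 < x.1 ∧ x.1 < i.2) (fun e he => ?_) hR
    obtain ⟨J, K, h⟩ := hch e he
    refine ⟨Finset.univ.image J, ?_, ?_, ?_⟩
    · intro x hx
      obtain ⟨j, -, rfl⟩ := Finset.mem_image.mp hx
      exact mem_finsetA.mpr (h.typeA j).1
    · rw [Finset.card_image_of_injective _ (fun i j hij =>
        h.strictMono_typeA.injective (congrArg Prod.fst hij))]
      simp
    · intro x hx
      obtain ⟨j, -, rfl⟩ := Finset.mem_image.mp hx
      exact ⟨(h.typeA j).2.1, (h.typeA j).1.crossing.lt.trans (h.typeA j).2.2⟩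
  -- Each parent has one more child of type B than of type A.
  · have := hsum (fun n => n + 1)
    simp only [Nat.sub_add_cancel (ha k)] at this
    rw [← this]
    refine sum_le_card_of_disjoint _ _ _ (fun i x => i.1 < x.1 ∧ x.1 < i.2) (fun e he => ?_) hR
    obtain ⟨J, K, h⟩ := hch e he
    refine ⟨Finset.univ.image K, ?_, ?_, ?_⟩
    · intro x hx
      obtain ⟨j, -, rfl⟩ := Finset.mem_image.mp hx
      exact mem_finsetB.mpr (h.typeB j).1
    · rw [Finset.card_image_of_injective _ (fun i j hij =>
        h.strictMono_typeB.injective (congrArg Prod.fst hij))]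
      simp
    · intro x hx
      obtain ⟨j, -, rfl⟩ := Finset.mem_image.mp hx
      exact ⟨(h.typeB j).2.1, (h.typeB j).1.crossing.lt.trans (h.typeB j).2.2⟩

theorem crossing_sub_const (v : ℝ) : Crossing (fun e => e - v) (v - 2) (v + 2) where
  lt := by linarith
  le x hx := abs_le.mpr ⟨by linarith [hx.1], by linarith [hx.2]⟩
  abs_left := by norm_num
  opp := by ring
  accL ε hε := ⟨v - 2 - ε / 2, ⟨by linarith, by linarith⟩, by
    rw [lt_abs]; right; linarith⟩
  accR ε hε := ⟨v + 2 + ε / 2, ⟨by linarith, by linarith⟩, by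
    rw [lt_abs]; left; linarith⟩

theorem crossingA_zero : CrossingA V a 0 (-2, 2) where
  crossing := by
    have := crossing_sub_const 0
    norm_num at this
    convert this using 2 with x
    simp [tr, traces]
  le x _ := by simp [trPrev, traces]
  parent j hj := by omega

/-- At level `0` one has `tr (M_{-1} M_0) = E - V` and `t_{-1} = 2`, so `[V - 2, V + 2]` can be fed
to the nesting argument. This band has no parent crossing at level `-1`. -/
theorem exists_crossingB_one (hV : 0 < V) (ha : 1 ≤ a 1) : ∃ e, CrossingB V a 1 e := by
  obtain ⟨e, he, -⟩ := exists_crossingB (a := a) hV (k := 0) ha (e := (V - 2, V + 2))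
    (by
      convert crossing_sub_const V using 2 with x
      simp [trMul, traces])
    (fun x _ => by simp [trPrev, traces]) (fun j hj => by omega)
  exact ⟨e, he⟩

/-- With `A_k`, `B_k` the numbers of crossings of each type, the induction carries `q_k ≤ A_k + B_k`
and `q_{k-1} + A_k ≤ B_{k+1}`. The second is needed because the type B crossings at level `k + 1`
are not produced from level `k`. -/
theorem convDen_le_card (hV : 0 < V) (ha : ∀ k, 1 ≤ a (k + 1)) (k : ℕ) :
    convDen a (k + 1) ≤ (finsetA V a k).card + (finsetB V a k).card ∧
    convDen a k + (finsetA V a k).card ≤ (finsetB V a (k + 1)).card := by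
  induction k with
  | zero =>
    have h1 : 1 ≤ (finsetA V a 0).card :=
      Finset.card_pos.mpr ⟨(-2, 2), mem_finsetA.mpr crossingA_zero⟩
    have h2 : 1 ≤ (finsetB V a 1).card := by
      obtain ⟨e, he⟩ := exists_crossingB_one hV (ha 0)
      exact Finset.card_pos.mpr ⟨e, mem_finsetB.mpr he⟩
    have h3 := card_add_card_le (V := V) (a := a) 0
    simp only [convDen, zero_add] at h3 ⊢
    omega
  | succ k ih =>
    obtain ⟨ih1, ih2⟩ := ih
    obtain ⟨h1, h2⟩ := card_children_le hV ha k
    have h3 := card_add_card_le (V := V) (a := a) k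
    have h4 := card_add_card_le (V := V) (a := a) (k + 1)
    obtain ⟨n, hn⟩ : ∃ n, a (k + 1) = n + 1 := ⟨a (k + 1) - 1, by have := ha k; omega⟩
    -- The degree bound turns the lower bound into an equality. At the next level it also gives an
    -- upper bound for `A_{k+1}`, which the second inequality requires.
    have h5 : (finsetA V a k).card + (finsetB V a k).card = convDen a (k + 1) := le_antisymm h3 ih1
    rw [show k + 1 + 1 = k + 2 from rfl] at *
    simp only [convDen, hn, Nat.add_sub_cancel] at h1 h2 h4 ⊢
    rw [← h5] at h4 ⊢
    constructor <;> nlinarith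

theorem convDen_pos (ha : ∀ k, 1 ≤ a (k + 1)) (k : ℕ) : 0 < convDen a (k + 1) := by
  induction k with
  | zero => simp [convDen]
  | succ k ih =>
    simp only [convDen]
    have := Nat.mul_pos (ha k) ih
    omega

theorem exists_mem_crossingA_or_crossingB (hV : 0 < V) (ha : ∀ k, 1 ≤ a (k + 1)) {k : ℕ} {x : ℝ}
    (hx : |tr V a k x| ≤ 2) :
    ∃ e : ℝ × ℝ, x ∈ Set.Icc e.1 e.2 ∧ (CrossingA V a k e ∨ CrossingB V a k e) := by
  classical
  have hcard := (convDen_le_card hV ha k).1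
  rw [← Finset.card_union_of_disjoint (disjoint_finsetA_finsetB k)] at hcard
  obtain ⟨e, he, hxe⟩ := exists_mem_crossing (convDen_pos ha k) (natDegree_traces_le k).2.1
    (fun e he => crossing_of_mem_union he) hcard hx
  exact ⟨e, hxe, (Finset.mem_union.mp he).imp mem_finsetA.mp mem_finsetB.mp⟩

end

/-! ### Transfer matrices and Floquet theory -/

/-- The one-step transfer matrix at energy `E` for the value `w` of the potential. -/
def stepMatrix (E w : ℝ) : Matrix (Fin 2) (Fin 2) ℝ := !![E - w, -1; 1, 0]

/-- The transfer matrix over the first `m` values of the potential `w`. -/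
def transfer (E : ℝ) (w : ℕ → ℝ) : ℕ → Matrix (Fin 2) (Fin 2) ℝ
  | 0 => 1
  | m + 1 => stepMatrix E (w m) * transfer E w m

theorem det_stepMatrix (E w : ℝ) : (stepMatrix E w).det = 1 := by
  simp [stepMatrix, Matrix.det_fin_two]

theorem det_transfer (E : ℝ) (w : ℕ → ℝ) (m : ℕ) : (transfer E w m).det = 1 := by
  induction m with
  | zero => simp [transfer]
  | succ m ih => rw [transfer, Matrix.det_mul, ih, det_stepMatrix, one_mul]

theorem transfer_add (E : ℝ) (w : ℕ → ℝ) (m n : ℕ) :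
    transfer E w (m + n) = transfer E (fun i => w (m + i)) n * transfer E w m := by
  induction n with
  | zero => simp [transfer]
  | succ n ih => rw [← add_assoc, transfer, ih, transfer, Matrix.mul_assoc]

theorem transfer_congr {E : ℝ} {w w' : ℕ → ℝ} {m : ℕ} (h : ∀ i < m, w i = w' i) :
    transfer E w m = transfer E w' m := by
  induction m with
  | zero => rfl
  | succ m ih => rw [transfer, transfer, ih fun i hi => h i (by omega), h m (by omega)]

theorem transfer_mul_of_periodic {E : ℝ} {w : ℕ → ℝ} {q : ℕ} (h : ∀ i, w (i + q) = w i) (n : ℕ) :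
    transfer E w (n * q) = transfer E w q ^ n := by
  induction n with
  | zero => simp [transfer]
  | succ n ih =>
    rw [add_mul, one_mul, add_comm, transfer_add, pow_succ]
    simp only [show ∀ i, w (q + i) = w i from fun i => by rw [add_comm, h], ih]

/-- Moving the base point by one conjugates the monodromy matrix by a one-step matrix. -/
theorem trace_transfer_shift {E : ℝ} {v : ℤ → ℝ} {q : ℕ} (h : ∀ n, v (n + q) = v n) (n n' : ℤ) :
    (transfer E (fun m : ℕ => v (n + m)) q).trace = (transfer E (fun m : ℕ => v (n' + m)) q).trace := by
  have key : ∀ n : ℤ, (transfer E (fun m : ℕ => v (n + 1 + m)) q).trace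
      = (transfer E (fun m : ℕ => v (n + m)) q).trace := by
    intro n
    have h1 : transfer E (fun m : ℕ => v (n + m)) (1 + q)
        = transfer E (fun m : ℕ => v (n + 1 + m)) q * stepMatrix E (v n) := by
      rw [transfer_add]
      simp [transfer, add_assoc]
    have h2 : transfer E (fun m : ℕ => v (n + m)) (1 + q)
        = stepMatrix E (v n) * transfer E (fun m : ℕ => v (n + m)) q := by
      rw [add_comm, transfer, h]
    have hd : IsUnit (stepMatrix E (v n)).det := by rw [det_stepMatrix]; exact isUnit_one
    have h3 : transfer E (fun m : ℕ => v (n + 1 + m)) q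
        = stepMatrix E (v n) * transfer E (fun m : ℕ => v (n + m)) q * (stepMatrix E (v n))⁻¹ := by
      rw [← h2, h1, Matrix.mul_assoc, Matrix.mul_nonsing_inv _ hd, Matrix.mul_one]
    rw [h3, Matrix.trace_mul_comm, ← Matrix.mul_assoc, Matrix.nonsing_inv_mul _ hd, Matrix.one_mul]
  have key2 : ∀ n : ℤ, (transfer E (fun m : ℕ => v (n + m)) q).trace
      = (transfer E (fun m : ℕ => v (0 + m)) q).trace := by
    intro n
    induction n using Int.induction_on with
    | zero => rfl
    | succ i ih => rw [key, ih]
    | pred i ih => rw [← ih, ← key, sub_add_cancel]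
  rw [key2 n, key2 n']

/-- The solution of the eigenvalue equation with given initial values. -/
def solution (E : ℝ) (w : ℕ → ℝ) (c₀ c₁ : ℂ) : ℕ → ℂ
  | 0 => c₀
  | 1 => c₁
  | m + 2 => ((E : ℂ) - w m) * solution E w c₀ c₁ (m + 1) - solution E w c₀ c₁ m

theorem solution_eq_transfer (E : ℝ) (w : ℕ → ℝ) (c₀ c₁ : ℂ) (m : ℕ) :
    solution E w c₀ c₁ (m + 1) = transfer E w m 0 0 * c₁ + transfer E w m 0 1 * c₀ ∧
    solution E w c₀ c₁ m = transfer E w m 1 0 * c₁ + transfer E w m 1 1 * c₀ := by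
  induction m with
  | zero => simp [solution, transfer]
  | succ m ih =>
    constructor
    · rw [solution, ih.1, ih.2]
      simp [transfer, stepMatrix, Matrix.mul_apply, Fin.sum_univ_two]
      ring
    · rw [ih.1]
      simp [transfer, stepMatrix, Matrix.mul_apply, Fin.sum_univ_two]

theorem solution_add_period {E : ℝ} {w : ℕ → ℝ} {q : ℕ} (h : ∀ i, w (i + q) = w i) (c₀ c₁ : ℂ)
    (m : ℕ) : solution E w c₀ c₁ (m + q)
      = solution E w (solution E w c₀ c₁ q) (solution E w c₀ c₁ (q + 1)) m := by
  have : solution E w c₀ c₁ (m + q)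
      = solution E w (solution E w c₀ c₁ q) (solution E w c₀ c₁ (q + 1)) m ∧
      solution E w c₀ c₁ (m + 1 + q)
      = solution E w (solution E w c₀ c₁ q) (solution E w c₀ c₁ (q + 1)) (m + 1) := by
    induction m with
    | zero => simp [solution, add_comm]
    | succ m ih =>
      refine ⟨ih.2, ?_⟩
      rw [solution, ← ih.1, ← ih.2, show m + 1 + 1 + q = (m + q) + 2 by ring, solution, h,
        show m + q + 1 = m + 1 + q by ring]
  exact this.1

theorem det_transfer_complex (E : ℝ) (w : ℕ → ℝ) (q : ℕ) :
    (transfer E w q 0 0 : ℂ) * transfer E w q 1 1 - transfer E w q 0 1 * transfer E w q 1 0 = 1 := by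
  have := det_transfer E w q
  rw [Matrix.det_fin_two] at this
  exact_mod_cast this

/-- Cayley–Hamilton for the unimodular monodromy matrix, read off on one component of a solution. -/
theorem solution_cayley {E : ℝ} {w : ℕ → ℝ} {q : ℕ} (h : ∀ i, w (i + q) = w i) (c₀ c₁ : ℂ) :
    solution E w c₀ c₁ (2 * q + 1) - (transfer E w q).trace * solution E w c₀ c₁ (q + 1) + c₁ = 0 := by
  have h1 := solution_eq_transfer E w c₀ c₁ q
  have h2 := (solution_eq_transfer E w (solution E w c₀ c₁ q) (solution E w c₀ c₁ (q + 1)) q).1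
  rw [← solution_add_period h, h1.1, h1.2] at h2
  rw [show 2 * q + 1 = q + 1 + q by ring, h2, h1.1, Matrix.trace_fin_two]
  push_cast
  linear_combination (-c₁) * det_transfer_complex E w q

/-- A discrete Gronwall estimate. The base `K + 2` is crude, but only independence from the sequence
matters. -/
theorem norm_sub_solution_le {E : ℝ} {w : ℕ → ℝ} {K h : ℝ} (hK : ∀ m, |E - w m| ≤ K) (hh : 0 ≤ h)
    {φ g : ℕ → ℂ} {L : ℕ} (hφ : ∀ m, φ (m + 2) = ((E : ℂ) - w m) * φ (m + 1) - φ m + g m)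
    (hg : ∀ m < L, ‖g m‖ ≤ h) (m : ℕ) (hm : m ≤ L + 1) :
    ‖φ m - solution E w (φ 0) (φ 1) m‖ ≤ (K + 2) ^ m * h := by
  have hK0 : 0 ≤ K := (abs_nonneg _).trans (hK 0)
  have key : (m ≤ L + 1 → ‖φ m - solution E w (φ 0) (φ 1) m‖ ≤ (K + 2) ^ m * h) ∧
      (m + 1 ≤ L + 1 → ‖φ (m + 1) - solution E w (φ 0) (φ 1) (m + 1)‖ ≤ (K + 2) ^ (m + 1) * h) := by
    induction m with
    | zero =>
      refine ⟨fun _ => ?_, fun _ => ?_⟩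
      · simp [solution, hh]
      · simp only [solution, zero_add, sub_self, norm_zero]; positivity
    | succ m ih =>
      refine ⟨(ih (by omega)).2, fun hm' => ?_⟩
      have h1 := (ih (by omega)).1 (by omega)
      have h2 := (ih (by omega)).2 (by omega)
      rw [hφ, solution, show ((E : ℂ) - w m) * φ (m + 1) - φ m + g m -
        (((E : ℂ) - w m) * solution E w (φ 0) (φ 1) (m + 1) - solution E w (φ 0) (φ 1) m)
        = ((E : ℂ) - w m) * (φ (m + 1) - solution E w (φ 0) (φ 1) (m + 1))
          - (φ m - solution E w (φ 0) (φ 1) m) + g m by ring]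
      refine (norm_add_le _ _).trans ((add_le_add (norm_sub_le _ _) (hg m (by omega))).trans ?_)
      rw [norm_mul]
      have h3 : ‖(E : ℂ) - w m‖ ≤ K := by
        rw [← Complex.ofReal_sub, Complex.norm_real]; exact hK m
      have h4 := mul_le_mul h3 h2 (norm_nonneg _) hK0
      have h5 : 1 ≤ (K + 2) ^ m := one_le_pow₀ (by linarith)
      have h6 : 0 ≤ (K + 2) ^ m * h := by positivity
      have h7 : h ≤ (K + 2) ^ m * h := le_mul_of_one_le_left hh h5
      have h8 : (K + 2) ^ (m + 1 + 1) * h = K * ((K + 2) ^ (m + 1) * h)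
        + 2 * (K * ((K + 2) ^ m * h)) + 4 * ((K + 2) ^ m * h) := by ring
      rw [h8]
      have := mul_nonneg hK0 h6
      linarith
  exact key.1 hm

theorem norm_floquet_le {E : ℝ} {w : ℕ → ℝ} {q : ℕ} (hper : ∀ i, w (i + q) = w i) {K h : ℝ}
    (hK : ∀ m, |E - w m| ≤ K) (hh : 0 ≤ h) {φ g : ℕ → ℂ}
    (hφ : ∀ m, φ (m + 2) = ((E : ℂ) - w m) * φ (m + 1) - φ m + g m)
    (hg : ∀ m < 2 * q, ‖g m‖ ≤ h) :
    ‖φ (2 * q + 1) + φ 1 - (transfer E w q).trace * φ (q + 1)‖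
      ≤ ((K + 2) ^ (2 * q + 1) + |(transfer E w q).trace| * (K + 2) ^ (q + 1)) * h := by
  have h1 := norm_sub_solution_le hK hh hφ hg (2 * q + 1) (by omega)
  have h2 := norm_sub_solution_le hK hh hφ hg (q + 1) (by omega)
  have h3 := solution_cayley (E := E) hper (φ 0) (φ 1)
  rw [show φ (2 * q + 1) + φ 1 - (transfer E w q).trace * φ (q + 1)
    = (φ (2 * q + 1) - solution E w (φ 0) (φ 1) (2 * q + 1))
      - (transfer E w q).trace * (φ (q + 1) - solution E w (φ 0) (φ 1) (q + 1)) by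
    linear_combination h3]
  refine (norm_sub_le _ _).trans ?_
  rw [norm_mul, Complex.norm_real, Real.norm_eq_abs, add_mul, mul_assoc]
  exact add_le_add h1 (mul_le_mul_of_nonneg_left h2 (abs_nonneg _))

/-- When the trace has modulus at most `2`, the characteristic polynomial `l² - t l + 1` has a root
on the unit circle; an eigenvector for it supplies the initial data. -/
theorem exists_floquet_solution (E : ℝ) {w : ℕ → ℝ} {q : ℕ} (hper : ∀ i, w (i + q) = w i)
    (ht : |(transfer E w q).trace| ≤ 2) :
    ∃ c₀ c₁ l : ℂ, (c₀ ≠ 0 ∨ c₁ ≠ 0) ∧ ‖l‖ = 1 ∧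
      ∀ m, solution E w c₀ c₁ (m + q) = l * solution E w c₀ c₁ m := by
  obtain ⟨t, htt⟩ : ∃ t, t = (transfer E w q).trace := ⟨_, rfl⟩
  rw [← htt] at ht
  have ht4 : t ^ 2 ≤ 4 := by
    have := sq_le_sq' (abs_le.mp ht).1 (abs_le.mp ht).2; linarith
  obtain ⟨r, hr⟩ : ∃ r, r = √(1 - t ^ 2 / 4) := ⟨_, rfl⟩
  have hr2 : r ^ 2 = 1 - t ^ 2 / 4 := by rw [hr]; exact Real.sq_sqrt (by linarith)
  obtain ⟨l, hl⟩ : ∃ l : ℂ, l = t / 2 + r * Complex.I := ⟨_, rfl⟩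
  have hl2 : l ^ 2 - t * l + 1 = 0 := by
    have hr2' : (r : ℂ) ^ 2 = 1 - (t : ℂ) ^ 2 / 4 := by exact_mod_cast hr2
    rw [hl]
    linear_combination (r : ℂ) ^ 2 * Complex.I_sq - hr2'
  have hl1 : ‖l‖ = 1 := by
    have : ‖l‖ ^ 2 = 1 := by
      rw [← Complex.normSq_eq_norm_sq, hl, show (t : ℂ) / 2 + r * Complex.I
        = ((t / 2 : ℝ) : ℂ) + (r : ℂ) * Complex.I by push_cast; rfl, Complex.normSq_add_mul_I, hr2]
      ring
    exact (pow_eq_one_iff_of_nonneg (norm_nonneg l) two_ne_zero).mp this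
  have htr : (t : ℂ) = transfer E w q 0 0 + transfer E w q 1 1 := by
    rw [htt, Matrix.trace_fin_two]; push_cast; rfl
  have hdet : (!![(transfer E w q 0 0 : ℂ) - l, transfer E w q 0 1;
      transfer E w q 1 0, transfer E w q 1 1 - l]).det = 0 := by
    rw [Matrix.det_fin_two_of]
    linear_combination hl2 + det_transfer_complex E w q + l * htr
  obtain ⟨v, hv, hv0⟩ := Matrix.exists_mulVec_eq_zero_iff.mpr hdet
  have e0 := congrFun hv0 0
  have e1 := congrFun hv0 1
  simp [Matrix.mulVec, dotProduct, Fin.sum_univ_two] at e0 e1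
  -- The transfer matrix acts on pairs `(φ (m + 1), φ m)`, hence the reversed order of the initial
  -- values.
  refine ⟨v 1, v 0, l, ?_, hl1, fun m => ?_⟩
  · by_contra hcon
    push Not at hcon
    refine hv (funext fun i => ?_)
    fin_cases i
    · exact hcon.2
    · exact hcon.1
  · have h1 := solution_eq_transfer E w (v 1) (v 0) q
    have h2 : solution E w (v 1) (v 0) (q + 1) = l * v 0 := by
      rw [h1.1]; linear_combination e0
    have h3 : solution E w (v 1) (v 0) q = l * v 1 := by
      rw [h1.2]; linear_combination e1
    rw [solution_add_period hper, h2, h3]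
    have : solution E w (l * v 1) (l * v 0) m = l * solution E w (v 1) (v 0) m ∧
        solution E w (l * v 1) (l * v 0) (m + 1) = l * solution E w (v 1) (v 0) (m + 1) := by
      induction m with
      | zero => exact ⟨rfl, rfl⟩
      | succ m ih =>
        refine ⟨ih.2, ?_⟩
        rw [solution, ih.1, ih.2, solution]
        ring
    exact this.1

theorem norm_shift_apply_le (m : ℤ) (ψ : Ell2) : ‖shift m ψ‖ ≤ ‖ψ‖ := by
  have h : ‖shift m‖ ≤ 1 := LinearMap.mkContinuous_norm_le _ zero_le_one _
  simpa using (shift m).le_of_opNorm_le h ψ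

theorem shift_apply (m : ℤ) (ψ : Ell2) (n : ℤ) : shift m ψ n = ψ (n + m) := rfl

theorem isSelfAdjoint_hamiltonian (α V : ℝ) : IsSelfAdjoint (hamiltonian α V) := by
  rw [ContinuousLinearMap.isSelfAdjoint_iff_isSymmetric]
  have hshift : ∀ (m : ℤ) (ψ φ : Ell2), inner ℂ (shift m ψ) φ = inner ℂ ψ (shift (-m) φ) := by
    intro m ψ φ
    rw [lp.inner_eq_tsum, lp.inner_eq_tsum,
      ← (Equiv.addRight m).tsum_eq fun n => inner ℂ (ψ n) (shift (-m) φ n)]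
    refine tsum_congr fun n => ?_
    simp only [shift_apply, Equiv.coe_addRight, add_neg_cancel_right]
  have hpot : ∀ ψ φ : Ell2, inner ℂ (potentialOp α V ψ) φ = inner ℂ ψ (potentialOp α V φ) := by
    intro ψ φ
    rw [lp.inner_eq_tsum, lp.inner_eq_tsum]
    refine tsum_congr fun n => ?_
    change inner ℂ ((potential α V n : ℂ) * ψ n) (φ n) = inner ℂ (ψ n) ((potential α V n : ℂ) * φ n)
    simp only [RCLike.inner_apply, map_mul, Complex.conj_ofReal]
    ring
  intro ψ φ
  simp only [hamiltonian, ContinuousLinearMap.coe_coe, add_apply, inner_add_left,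
    inner_add_right, hshift, hpot, neg_neg]
  ring

/-- The sequence of absolute values of an element of `ℓ²(ℤ)`. -/
def absSeq (f : Ell2) : Ell2 :=
  ⟨fun n => (‖f n‖ : ℂ), Memℓp.mono (g := fun n => ‖f n‖) (memℓp_norm_iff.mpr (lp.memℓp f))
    (fun n => by simp)⟩

theorem absSeq_apply (f : Ell2) (n : ℤ) : absSeq f n = (‖f n‖ : ℂ) := rfl

theorem norm_absSeq_le (f : Ell2) : ‖absSeq f‖ ≤ ‖f‖ :=
  lp.norm_mono (p := 2) (by norm_num) fun n => by simp [absSeq_apply]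

theorem abs_potential_le (α V : ℝ) (n : ℤ) : |potential α V n| ≤ |V| :=
  norm_indicator_le_norm_self (fun _ => V) _

/-- For an exact solution `ψ (n + q) + ψ (n - q) = t ψ n`. For a general `ψ` the defect at `n` is
controlled by the values of `(H - E) ψ` within one period of `n`, and summing the shifted absolute
values makes this an `ℓ²` bound. -/
theorem norm_floquet_operator_le {α V : ℝ} (E : ℝ) {q : ℕ}
    (hper : ∀ n, potential α V (n + q) = potential α V n) (n₀ : ℤ) :
    ∃ C : ℝ, ∀ ψ : Ell2, ‖shift q ψ + shift (-q) ψ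
        - ((transfer E (fun m : ℕ => potential α V (n₀ + m)) q).trace : ℂ) • ψ‖
      ≤ C * ‖hamiltonian α V ψ - (E : ℂ) • ψ‖ := by
  obtain ⟨t, ht⟩ : ∃ t, t = (transfer E (fun m : ℕ => potential α V (n₀ + m)) q).trace := ⟨_, rfl⟩
  rw [← ht]
  obtain ⟨K, hK⟩ : ∃ K, K = |E| + |V| := ⟨_, rfl⟩
  have hK0 : 0 ≤ K := by rw [hK]; positivity
  obtain ⟨C, hC⟩ : ∃ C, C = (K + 2) ^ (2 * q + 1) + |t| * (K + 2) ^ (q + 1) := ⟨_, rfl⟩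
  have hC0 : 0 ≤ C := by rw [hC]; positivity
  refine ⟨C * (2 * q), fun ψ => ?_⟩
  obtain ⟨f, hf⟩ : ∃ f : Ell2, f = hamiltonian α V ψ - (E : ℂ) • ψ := ⟨_, rfl⟩
  rw [← hf]
  obtain ⟨H, hH⟩ : ∃ H : Ell2, H = ∑ j ∈ Finset.range (2 * q), shift (-q + j) (absSeq f) := ⟨_, rfl⟩
  have hHn : ∀ n, H n = ((∑ j ∈ Finset.range (2 * q), ‖f (n + (-q + j))‖ : ℝ) : ℂ) := by
    intro n
    rw [hH, lp.coeFn_sum, Finset.sum_apply]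
    push_cast
    rfl
  have hHnorm : ‖H‖ ≤ 2 * q * ‖f‖ := by
    rw [hH]
    refine (norm_sum_le _ _).trans ((Finset.sum_le_sum fun j _ =>
      (norm_shift_apply_le _ _).trans (norm_absSeq_le f)).trans (le_of_eq ?_))
    simp
  have hmain : ‖shift q ψ + shift (-q) ψ - (t : ℂ) • ψ‖ ≤ ‖(C : ℂ) • H‖ := by
    refine lp.norm_mono (p := 2) (by norm_num) fun n => ?_
    have h1 := norm_floquet_le (E := E) (w := fun m : ℕ => potential α V (n - q + m)) (q := q)
      (fun i => by
        simp only [Nat.cast_add]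
        rw [← add_assoc, hper]) (K := K) (h := ∑ j ∈ Finset.range (2 * q), ‖f (n + (-q + j))‖)
      (fun m => by
        rw [hK]
        exact (abs_sub _ _).trans (add_le_add le_rfl (abs_potential_le _ _ _)))
      (Finset.sum_nonneg fun _ _ => norm_nonneg _)
      (φ := fun m : ℕ => ψ (n - q + m - 1)) (g := fun m : ℕ => f (n - q + m))
      (fun m => by
        rw [hf]
        change _ = _ + (ψ (n - q + m - 1) + ψ (n - q + m + 1)
          + (potential α V (n - q + m) : ℂ) * ψ (n - q + m) - (E : ℂ) * ψ (n - q + m))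
        have e1 : n - q + ((m + 2 : ℕ) : ℤ) - 1 = n - q + m + 1 := by push_cast; ring
        have e2 : n - q + ((m + 1 : ℕ) : ℤ) - 1 = n - q + m := by push_cast; ring
        rw [e1, e2]
        ring)
      (fun m hm => by
        have : n - q + (m : ℤ) = n + (-q + m) := by ring
        rw [this]
        exact Finset.single_le_sum (f := fun j : ℕ => ‖f (n + (-q + j))‖)
          (fun _ _ => norm_nonneg _) (Finset.mem_range.mpr hm))
    rw [trace_transfer_shift hper _ n₀, ← ht, ← hC] at h1
    have e1 : n - q + ((2 * q + 1 : ℕ) : ℤ) - 1 = n + q := by push_cast; ring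
    have e2 : n - q + ((1 : ℕ) : ℤ) - 1 = n + -q := by push_cast; ring
    have e3 : n - q + ((q + 1 : ℕ) : ℤ) - 1 = n := by push_cast; ring
    rw [e1, e2, e3] at h1
    change ‖ψ (n + q) + ψ (n + -q) - (t : ℂ) * ψ n‖ ≤ ‖(C : ℂ) * H n‖
    refine h1.trans (le_of_eq ?_)
    rw [hHn, norm_mul, Complex.norm_real, Complex.norm_real, Real.norm_of_nonneg hC0,
      Real.norm_of_nonneg (Finset.sum_nonneg fun _ _ => norm_nonneg _)]
  refine hmain.trans ?_
  rw [norm_smul, Complex.norm_real, Real.norm_of_nonneg hC0, mul_assoc]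
  exact mul_le_mul_of_nonneg_left hHnorm hC0

/-- The two translations together have norm at most `2`, so `|t| > 2` makes `H - E` bounded below; a
self-adjoint operator bounded below is invertible. -/
theorem notMem_spec_of_two_lt {α V E : ℝ} {q : ℕ}
    (hper : ∀ n, potential α V (n + q) = potential α V n) (n₀ : ℤ)
    (ht : 2 < |(transfer E (fun m : ℕ => potential α V (n₀ + m)) q).trace|) : E ∉ spec α V := by
  obtain ⟨C, hC⟩ := norm_floquet_operator_le E hper n₀
  obtain ⟨t, htt⟩ : ∃ t, t = (transfer E (fun m : ℕ => potential α V (n₀ + m)) q).trace := ⟨_, rfl⟩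
  rw [← htt] at ht hC
  obtain ⟨A, hA⟩ : ∃ A : Ell2 →L[ℂ] Ell2,
    A = algebraMap ℂ (Ell2 →L[ℂ] Ell2) (E : ℂ) - hamiltonian α V := ⟨_, rfl⟩
  have hAapp : ∀ ψ, A ψ = (E : ℂ) • ψ - hamiltonian α V ψ := fun ψ => by
    rw [hA, Algebra.algebraMap_eq_smul_one]; rfl
  have hbound : ∀ ψ, (|t| - 2) * ‖ψ‖ ≤ C * ‖A ψ‖ := by
    intro ψ
    rw [hAapp, norm_sub_rev]
    refine le_trans ?_ (hC ψ)
    have h1 := norm_shift_apply_le q ψ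
    have h2 := norm_shift_apply_le (-q) ψ
    have h3 : ‖(t : ℂ) • ψ‖ = |t| * ‖ψ‖ := by rw [norm_smul, Complex.norm_real, Real.norm_eq_abs]
    have h4 := norm_sub_norm_le ((t : ℂ) • ψ) (shift q ψ + shift (-q) ψ)
    rw [norm_sub_rev] at h4
    have h5 := norm_add_le (shift q ψ) (shift (-q) ψ)
    rw [sub_mul]
    linarith
  have hpos : 0 < |t| - 2 := by linarith
  have hanti : AntilipschitzWith (Real.toNNReal (|C| / (|t| - 2))) A := by
    refine A.antilipschitz_of_bound fun ψ => ?_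
    rw [Real.coe_toNNReal _ (by positivity), div_mul_eq_mul_div, le_div_iff₀ hpos, mul_comm]
    exact (hbound ψ).trans (mul_le_mul_of_nonneg_right (le_abs_self C) (norm_nonneg _))
  have hsa : IsSelfAdjoint A := by
    rw [hA]
    refine IsSelfAdjoint.sub ?_ (isSelfAdjoint_hamiltonian α V)
    rw [IsSelfAdjoint, ← algebraMap_star_comm]
    simp
  have hunit : IsUnit A := by
    rw [ContinuousLinearMap.isUnit_iff_bijective,
      ContinuousLinearMap.bijective_iff_dense_range_and_antilipschitz]
    refine ⟨?_, _, hanti⟩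
    -- Dense range: the orthogonal complement of the range is the kernel of the adjoint, here of `A`
    -- itself.
    rw [Submodule.topologicalClosure_eq_top_iff, ContinuousLinearMap.orthogonal_range,
      ContinuousLinearMap.isSelfAdjoint_iff'.mp hsa]
    exact LinearMap.ker_eq_bot.mpr hanti.injective
  rw [hA] at hunit
  exact fun h => h hunit

theorem shift_single (m k : ℤ) (c : ℂ) :
    shift m (lp.single 2 k c : Ell2) = lp.single 2 (k - m) c := by
  refine lp.ext (funext fun n => ?_)
  rw [shift_apply, lp.coeFn_single, lp.coeFn_single, Pi.single_apply, Pi.single_apply]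
  simp only [eq_sub_iff_add_eq]

theorem potentialOp_single (α V : ℝ) (k : ℤ) (c : ℂ) :
    potentialOp α V (lp.single 2 k c : Ell2) = lp.single 2 k ((potential α V k : ℂ) * c) := by
  refine lp.ext (funext fun n => ?_)
  change (potential α V n : ℂ) * (lp.single 2 k c : Ell2) n = _
  rw [lp.coeFn_single, lp.coeFn_single, Pi.single_apply, Pi.single_apply]
  split_ifs with h
  · rw [h]
  · rw [mul_zero]

/-- A truncated solution satisfies the eigenvalue equation except for boundary terms, two at each
end. -/
theorem hamiltonian_sub_smul_sum_single (α V E : ℝ) (n₀ : ℤ) (c₀ c₁ : ℂ) {φ : ℕ → ℂ}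
    (hφ : φ = solution E (fun m : ℕ => potential α V (n₀ + m)) c₀ c₁) (L : ℕ) :
    hamiltonian α V (∑ m ∈ Finset.range L, lp.single 2 (n₀ + m) (φ (m + 1)))
      - (E : ℂ) • (∑ m ∈ Finset.range L, lp.single 2 (n₀ + m) (φ (m + 1)) : Ell2)
    = lp.single 2 (n₀ - 1) (φ 1) - lp.single 2 n₀ (φ 0) + lp.single 2 (n₀ + L) (φ L)
      - lp.single 2 (n₀ + L - 1) (φ (L + 1)) := by
  induction L with
  | zero => simp
  | succ L ih =>
    rw [Finset.sum_range_succ, map_add, smul_add, add_sub_add_comm, ih]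
    have hs : φ (L + 2) = ((E : ℂ) - potential α V (n₀ + L)) * φ (L + 1) - φ L := by
      rw [hφ, solution]
    have h1 : hamiltonian α V (lp.single 2 (n₀ + L) (φ (L + 1)) : Ell2)
        = lp.single 2 (n₀ + L + 1) (φ (L + 1)) + lp.single 2 (n₀ + L - 1) (φ (L + 1))
          + lp.single 2 (n₀ + L) ((potential α V (n₀ + L) : ℂ) * φ (L + 1)) := by
      simp only [hamiltonian, add_apply, shift_single, potentialOp_single,
        sub_neg_eq_add]
    have e1 : n₀ + ((L + 1 : ℕ) : ℤ) = n₀ + L + 1 := by push_cast; ring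
    have e2 : n₀ + L + 1 - 1 = n₀ + L := by ring
    rw [h1, e1, e2, show L + 1 + 1 = L + 2 from rfl, hs, sub_mul, lp.single_sub, lp.single_sub,
      ← lp.single_smul, smul_eq_mul]
    abel

/-- If `H - E` were invertible, truncations of a bounded Floquet solution would have bounded `ℓ²`
norm, since their images consist of four bounded boundary terms. A sequence of periodic modulus with
summable squares vanishes, contradicting the nonzero initial data. -/
theorem mem_spec_of_le_two {α V E : ℝ} {q : ℕ} (hq : 0 < q)
    (hper : ∀ n, potential α V (n + q) = potential α V n) (n₀ : ℤ)
    (ht : |(transfer E (fun m : ℕ => potential α V (n₀ + m)) q).trace| ≤ 2) : E ∈ spec α V := by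
  obtain ⟨c₀, c₁, l, hc, hl, hsol⟩ := exists_floquet_solution E (fun i => by
    simp only [Nat.cast_add]
    rw [← add_assoc, hper]) ht
  obtain ⟨φ, hφ⟩ : ∃ φ, φ = solution E (fun m : ℕ => potential α V (n₀ + m)) c₀ c₁ := ⟨_, rfl⟩
  rw [← hφ] at hsol
  have hnorm : Function.Periodic (fun m => ‖φ m‖) q := fun m => by
    simp only [hsol, norm_mul, hl, one_mul]
  obtain ⟨B, hB⟩ : ∃ B, B = ∑ i ∈ Finset.range q, ‖φ i‖ := ⟨_, rfl⟩
  have hφB : ∀ m, ‖φ m‖ ≤ B := by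
    intro m
    rw [hB, ← hnorm.map_mod_nat m]
    exact Finset.single_le_sum (f := fun i => ‖φ i‖) (fun _ _ => norm_nonneg _)
      (Finset.mem_range.mpr (Nat.mod_lt m hq))
  by_contra hcon
  have hunit : IsUnit (algebraMap ℂ (Ell2 →L[ℂ] Ell2) (E : ℂ) - hamiltonian α V) :=
    not_not.mp hcon
  obtain ⟨A, hA⟩ := hunit
  have hinv : ∀ ψ : Ell2, ‖ψ‖ ≤ ‖((A⁻¹ : (Ell2 →L[ℂ] Ell2)ˣ) : Ell2 →L[ℂ] Ell2)‖
      * ‖hamiltonian α V ψ - (E : ℂ) • ψ‖ := by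
    intro ψ
    have h1 : ((A⁻¹ : (Ell2 →L[ℂ] Ell2)ˣ) : Ell2 →L[ℂ] Ell2) ((A : Ell2 →L[ℂ] Ell2) ψ) = ψ := by
      rw [← mul_apply_eq_comp, Units.inv_mul, one_apply_eq_self]
    have h2 : (A : Ell2 →L[ℂ] Ell2) ψ = -(hamiltonian α V ψ - (E : ℂ) • ψ) := by
      rw [hA, neg_sub, Algebra.algebraMap_eq_smul_one]; rfl
    have h3 := ContinuousLinearMap.le_opNorm
      ((A⁻¹ : (Ell2 →L[ℂ] Ell2)ˣ) : Ell2 →L[ℂ] Ell2) ((A : Ell2 →L[ℂ] Ell2) ψ)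
    rwa [h1, h2, norm_neg] at h3
  obtain ⟨M, hM⟩ : ∃ M, M = ‖((A⁻¹ : (Ell2 →L[ℂ] Ell2)ˣ) : Ell2 →L[ℂ] Ell2)‖ := ⟨_, rfl⟩
  have hM0 : 0 ≤ M := by rw [hM]; exact norm_nonneg _
  rw [← hM] at hinv
  have hsum : ∀ L, ∑ m ∈ Finset.range L, ‖φ (m + 1)‖ ^ 2 ≤ (M * (4 * B)) ^ 2 := by
    intro L
    obtain ⟨ψ, hψ⟩ : ∃ ψ : Ell2, ψ = ∑ m ∈ Finset.range L, lp.single 2 (n₀ + m) (φ (m + 1)) :=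
      ⟨_, rfl⟩
    have h1 : ‖ψ‖ ≤ M * (4 * B) := by
      refine (hinv ψ).trans (mul_le_mul_of_nonneg_left ?_ hM0)
      rw [hψ, hamiltonian_sub_smul_sum_single α V E n₀ c₀ c₁ hφ]
      refine (norm_sub_le _ _).trans ((add_le_add ((norm_add_le _ _).trans
        (add_le_add (norm_sub_le _ _) le_rfl)) le_rfl).trans ?_)
      simp only [lp.norm_single (p := 2) (by norm_num)]
      linarith [hφB 1, hφB 0, hφB L, hφB (L + 1)]
    have h2 : ‖ψ‖ ^ 2 = ∑ m ∈ Finset.range L, ‖φ (m + 1)‖ ^ 2 := by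
      have hinj : Function.Injective fun m : ℕ => n₀ + (m : ℤ) := fun i j hij => by
        simpa using hij
      have h3 := lp.norm_sum_single (E := fun _ : ℤ => ℂ) (p := 2) (by norm_num)
        (fun i => φ ((i - n₀).toNat + 1)) ((Finset.range L).map ⟨_, hinj⟩)
      simp only [Finset.sum_map, Function.Embedding.coeFn_mk, add_sub_cancel_left,
        Int.toNat_natCast] at h3
      rw [← hψ] at h3
      simpa using h3
    rw [← h2]
    exact pow_le_pow_left₀ (norm_nonneg _) h1 2
  have hsummable := summable_of_sum_range_le (fun m => sq_nonneg ‖φ (m + 1)‖) hsum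
  have hlim := hsummable.tendsto_atTop_zero
  -- Along `m + j q` the modulus is constant in `j`, yet tends to zero.
  have hzero : ∀ m, φ (m + 1) = 0 := by
    intro m
    have hsub : Filter.Tendsto (fun j : ℕ => m + j * q) Filter.atTop Filter.atTop :=
      Filter.tendsto_atTop_mono (fun j => (Nat.le_mul_of_pos_right j hq).trans (Nat.le_add_left _ _))
        Filter.tendsto_id
    have h1 := hlim.comp hsub
    have h2 : ((fun m => ‖φ (m + 1)‖ ^ 2) ∘ fun j : ℕ => m + j * q) = fun _ => ‖φ (m + 1)‖ ^ 2 := by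
      funext j
      have := hnorm.nat_mul j (m + 1)
      simp only [Function.comp, Nat.cast_id] at this ⊢
      rw [show m + j * q + 1 = m + 1 + j * q by ring, this]
    rw [h2] at h1
    have h3 := tendsto_nhds_unique h1 tendsto_const_nhds
    simpa using h3.symm
  have h0 : φ 0 = 0 := by
    have := hsol 0
    obtain ⟨r, hr⟩ : ∃ r, q = r + 1 := ⟨q - 1, by omega⟩
    rw [zero_add, hr, hzero] at this
    have hl0 : l ≠ 0 := fun h => by simp [h] at hl
    exact (mul_eq_zero.mp this.symm).resolve_left hl0
  have h1 := hzero 0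
  rw [hφ] at h0 h1
  rcases hc with hc | hc
  · exact hc h0
  · exact hc h1

/-- Floquet theory: the spectrum of a periodic Schrödinger operator is determined by the trace of
the monodromy matrix. -/
theorem mem_spec_iff {α V E : ℝ} {q : ℕ} (hq : 0 < q)
    (hper : ∀ n, potential α V (n + q) = potential α V n) (n₀ : ℤ) :
    E ∈ spec α V ↔ |(transfer E (fun m : ℕ => potential α V (n₀ + m)) q).trace| ≤ 2 :=
  ⟨fun h => not_lt.mp fun hlt => notMem_spec_of_two_lt hper n₀ hlt h, mem_spec_of_le_two hq hper n₀⟩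

/-! ### Mechanical words and the recursion of monodromy matrices -/

theorem sq_eq_of_det_eq_one {Y : Matrix (Fin 2) (Fin 2) ℝ} (hY : Y.det = 1) :
    Y * Y = Y.trace • Y - 1 := by
  rw [Matrix.det_fin_two] at hY
  ext i j
  fin_cases i <;> fin_cases j <;>
    simp [Matrix.mul_apply, Fin.sum_univ_two, Matrix.trace_fin_two] <;>
    first | ring1 | linear_combination -hY

theorem chain_trace (X : Matrix (Fin 2) (Fin 2) ℝ) {Y : Matrix (Fin 2) (Fin 2) ℝ}
    (hY : Y.det = 1) (n : ℕ) :
    chain X.trace Y.trace (X * Y).trace n = (X * Y ^ n).trace := by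
  have : chain X.trace Y.trace (X * Y).trace n = (X * Y ^ n).trace ∧
      chain X.trace Y.trace (X * Y).trace (n + 1) = (X * Y ^ (n + 1)).trace := by
    induction n with
    | zero => simp [chain]
    | succ n ih =>
      refine ⟨ih.2, ?_⟩
      have h2 : Y ^ (n + 2) = Y ^ n * (Y * Y) := by rw [pow_add, pow_two]
      rw [chain, ih.1, ih.2, show n + 1 + 1 = n + 2 from rfl, h2, sq_eq_of_det_eq_one hY, pow_succ, mul_sub, mul_one, mul_smul_comm, mul_sub, mul_smul_comm,
        Matrix.trace_sub, Matrix.trace_smul, smul_eq_mul]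
  exact this.1

/-- The numerators of the convergents, shifted by one: `convNum a (k + 1) = p_k`. -/
def convNum (a : ℕ → ℕ) : ℕ → ℕ
  | 0 => 1
  | 1 => 0
  | k + 2 => a (k + 1) * convNum a (k + 1) + convNum a k

/-- The parity of `k`, as an integer. -/
def parity : ℕ → ℤ
  | 0 => 0
  | k + 1 => 1 - parity k

theorem parity_eq (k : ℕ) : parity k = 0 ∨ parity k = 1 := by
  induction k with
  | zero => exact Or.inl rfl
  | succ k ih => rw [parity]; omega

theorem conv_det (a : ℕ → ℕ) (k : ℕ) :
    (convNum a (k + 2) : ℤ) * convDen a (k + 1) - convNum a (k + 1) * convDen a (k + 2)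
      = 1 - 2 * parity k := by
  induction k with
  | zero => simp [convNum, convDen, parity]
  | succ k ih =>
    have h1 : convNum a (k + 1 + 2) = a (k + 2) * convNum a (k + 2) + convNum a (k + 1) := rfl
    have h2 : convDen a (k + 1 + 2) = a (k + 2) * convDen a (k + 2) + convDen a (k + 1) := rfl
    rw [h1, h2, parity]
    push_cast
    linear_combination -ih

/-- For consecutive convergents the numerators of the two remainders satisfy `q (N p' - F q') = q'
(N p - F q) ± N`. As `1 ≤ N ≤ q'`, this perturbation is too small to cross an integer, except for
ties, which the offsets `s` and `1 - s` resolve. -/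
theorem ediv_eq_ediv_of_det {p q p' q' s N : ℤ} (hq : 0 < q) (hq' : 0 < q')
    (hdet : p' * q - p * q' = 1 - 2 * s) (hs : s = 0 ∨ s = 1) (h1 : 1 ≤ N) (hN : N ≤ q') :
    (N * p - s) / q = (N * p' - (1 - s)) / q' := by
  obtain ⟨F, hF⟩ : ∃ F, F = (N * p - s) / q := ⟨_, rfl⟩
  rw [← hF]
  have hF1 : F * q ≤ N * p - s := by rw [hF]; exact Int.ediv_mul_le _ hq.ne'
  have hF2 : N * p - s < (F + 1) * q := by rw [hF]; exact Int.lt_ediv_add_one_mul_self _ hq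
  symm
  rw [Int.ediv_eq_iff_of_pos hq']
  have e : q * (N * p' - F * q') = q' * (N * p - F * q) + N * (1 - 2 * s) := by
    linear_combination N * hdet
  rcases hs with rfl | rfl
  · have hX0 : 0 ≤ N * p - F * q := by linarith
    have hX1 : N * p - F * q ≤ q - 1 := by linarith
    have hY0 : 0 < N * p' - F * q' := by
      by_contra hcon
      nlinarith [mul_nonneg hq'.le hX0]
    have hY1 : N * p' - F * q' ≤ q' := by
      by_contra hcon
      nlinarith [mul_le_mul_of_nonneg_left hX1 hq'.le]
    constructor <;> linarith
  · have hX0 : 1 ≤ N * p - F * q := by linarith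
    have hX1 : N * p - F * q ≤ q := by linarith
    have hY0 : 0 ≤ N * p' - F * q' := by
      by_contra hcon
      nlinarith [mul_le_mul_of_nonneg_left hX0 hq'.le]
    have hY1 : N * p' - F * q' < q' := by
      by_contra hcon
      nlinarith [mul_le_mul_of_nonneg_left hX1 hq'.le]
    constructor <;> linarith

/-- The counting function of the mechanical word of slope `p_k / q_k`. -/
def height (a : ℕ → ℕ) (k : ℕ) (n : ℤ) : ℤ :=
  ((n + 1) * convNum a (k + 1) - parity k) / convDen a (k + 1)

/-- The letters of the mechanical word of slope `p_k / q_k`. -/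
def letter (a : ℕ → ℕ) (k : ℕ) (n : ℤ) : ℤ := height a k (n + 1) - height a k n

section

variable {a : ℕ → ℕ}

theorem convDen_int_pos (ha : ∀ k, 1 ≤ a (k + 1)) (k : ℕ) : (0 : ℤ) < convDen a (k + 1) := by
  exact_mod_cast convDen_pos ha k

theorem convDen_le_succ (ha : ∀ k, 1 ≤ a (k + 1)) (k : ℕ) :
    convDen a (k + 1) ≤ convDen a (k + 2) := by
  rw [convDen]
  exact (Nat.le_mul_of_pos_left _ (ha k)).trans (Nat.le_add_right _ _)

theorem convNum_le_convDen (ha : ∀ k, 1 ≤ a (k + 1)) (k : ℕ) :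
    convNum a (k + 1) ≤ convDen a (k + 1) := by
  have : convNum a (k + 1) ≤ convDen a (k + 1) ∧ convNum a (k + 2) ≤ convDen a (k + 2) := by
    induction k with
    | zero => simpa [convNum, convDen] using ha 0
    | succ k ih =>
      refine ⟨ih.2, ?_⟩
      rw [convNum, convDen]
      exact add_le_add (Nat.mul_le_mul_left _ ih.2) ih.1
  exact this.1

theorem height_add_mul (ha : ∀ k, 1 ≤ a (k + 1)) (k : ℕ) (n c : ℤ) :
    height a k (n + c * convDen a (k + 1)) = height a k n + c * convNum a (k + 1) := by
  rw [height, height, ← Int.add_mul_ediv_right _ _ (convDen_int_pos ha k).ne']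
  congr 1
  ring

/-- This is why the parity offset enters `height`: with it, the counting functions of consecutive
levels agree over a whole period of the finer one. -/
theorem height_succ_eq (ha : ∀ k, 1 ≤ a (k + 1)) (k : ℕ) {n : ℤ} (hn : 0 ≤ n)
    (hn' : n < convDen a (k + 2)) : height a (k + 1) n = height a k n :=
  (ediv_eq_ediv_of_det (convDen_int_pos ha k) (convDen_int_pos ha (k + 1)) (conv_det a k)
    (parity_eq k) (by linarith) (by linarith)).symm

theorem height_zero (ha : ∀ k, 1 ≤ a (k + 1)) (k : ℕ) : height a k 0 = 0 := by
  induction k with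
  | zero => simp [height, convNum, parity]
  | succ k ih => rw [height_succ_eq ha k le_rfl (convDen_int_pos ha (k + 1)), ih]

theorem height_convDen (ha : ∀ k, 1 ≤ a (k + 1)) (k : ℕ) :
    height a k (convDen a (k + 1)) = convNum a (k + 1) := by
  have := height_add_mul ha k 0 1
  rwa [zero_add, one_mul, one_mul, height_zero ha, zero_add] at this

/-- The word of level `k + 2` is `a (k + 2)` copies of the word of level `k + 1` followed by the
word of level `k`. At `n = q_k` agreement of consecutive levels is no longer available, and the
full-period values are compared instead. -/
theorem height_concat (ha : ∀ k, 1 ≤ a (k + 1)) (k : ℕ) {n : ℤ} (hn : 0 ≤ n)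
    (hn' : n ≤ convDen a (k + 1)) :
    height a (k + 2) (a (k + 2) * convDen a (k + 2) + n)
      = a (k + 2) * convNum a (k + 2) + height a k n := by
  have h1 : (convDen a (k + 3) : ℤ) = a (k + 2) * convDen a (k + 2) + convDen a (k + 1) := by
    rw [convDen]; push_cast; ring
  have h2 : (convNum a (k + 3) : ℤ) = a (k + 2) * convNum a (k + 2) + convNum a (k + 1) := by
    rw [convNum]; push_cast; ring
  have h3 : (convDen a (k + 1) : ℤ) ≤ convDen a (k + 2) := by
    exact_mod_cast convDen_le_succ ha k
  rcases eq_or_lt_of_le hn' with h | h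
  · rw [h, ← h1, height_convDen ha (k + 2), height_convDen ha k, h2]
  · rw [height_succ_eq ha (k + 1) (by positivity) (by rw [h1]; linarith),
      add_comm (_ * _) n, height_add_mul ha (k + 1), height_succ_eq ha k hn (h.trans_le h3), add_comm]

theorem letter_add_convDen (ha : ∀ k, 1 ≤ a (k + 1)) (k : ℕ) (n : ℤ) :
    letter a k (n + convDen a (k + 1)) = letter a k n := by
  have h1 := height_add_mul ha k n 1
  have h2 := height_add_mul ha k (n + 1) 1
  rw [one_mul] at h1 h2
  rw [letter, letter, h1, show n + convDen a (k + 1) + 1 = n + 1 + convDen a (k + 1) by ring, h2]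
  ring

/-- The monodromy matrices `M_{k-1}` at energy `E`. -/
def monodromy (V : ℝ) (a : ℕ → ℕ) (E : ℝ) : ℕ → Matrix (Fin 2) (Fin 2) ℝ
  | 0 => !![1, -V; 0, 1]
  | k + 1 => transfer E (fun m : ℕ => V * letter a k m) (convDen a (k + 1))

theorem det_monodromy (V : ℝ) (E : ℝ) (k : ℕ) : (monodromy V a E k).det = 1 := by
  cases k with
  | zero => simp [monodromy, Matrix.det_fin_two]
  | succ k => exact det_transfer _ _ _

theorem transfer_const_zero (E : ℝ) (n : ℕ) :
    transfer E (fun _ => 0) n = stepMatrix E 0 ^ n := by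
  induction n with
  | zero => rfl
  | succ n ih => rw [transfer, ih, pow_succ']

/-- Concatenation of words becomes a product of matrices, with later letters on the left. -/
theorem monodromy_add_two (ha : ∀ k, 1 ≤ a (k + 1)) (V E : ℝ) (k : ℕ) :
    monodromy V a E (k + 2) = monodromy V a E k * monodromy V a E (k + 1) ^ a (k + 1) := by
  cases k with
  | zero =>
    -- No word stands behind `M_{-1}`, so this case is computed: the word of slope `1 / a_1` is
    -- `0…01`, and `M_{-1}` turns the step matrix for potential `0` into the one for `V`.
    obtain ⟨n, hn⟩ : ∃ n, a 1 = n + 1 := ⟨a 1 - 1, by have : 1 ≤ a 1 := ha 0; omega⟩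
    have hh : ∀ m : ℤ, height a 1 m = m / (n + 1 : ℕ) := by
      intro m; simp [height, convNum, convDen, parity, hn]
    have hl0 : ∀ m < n, letter a 1 m = 0 := by
      intro m hm
      rw [letter, hh, hh, Int.ediv_eq_zero_of_lt (by positivity) (by exact_mod_cast by omega),
        Int.ediv_eq_zero_of_lt (by positivity) (by exact_mod_cast by omega), sub_zero]
    have hl1 : letter a 1 n = 1 := by
      rw [letter, hh, hh, Int.ediv_eq_zero_of_lt (a := (n : ℤ)) (by positivity)
        (by exact_mod_cast by omega), sub_zero]
      exact Int.ediv_self (by positivity)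
    have h0 : monodromy V a E 1 = stepMatrix E 0 := by
      simp [monodromy, convDen, transfer, letter, height, convNum, parity]
    have h1 : !![1, -V; 0, 1] * stepMatrix E 0 = stepMatrix E V := by
      ext i j
      fin_cases i <;> fin_cases j <;> simp [stepMatrix, sub_eq_add_neg]
    rw [zero_add, h0, hn, pow_succ', ← Matrix.mul_assoc, monodromy, h1, monodromy,
      show convDen a (0 + 1 + 1) = n + 1 by simp [convDen, hn], transfer]
    rw [hl1, ← transfer_const_zero]
    congr 1
    · simp
    · exact transfer_congr fun i hi => by rw [hl0 i hi]; simp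
  | succ k =>
    rw [monodromy, monodromy, monodromy, ← transfer_mul_of_periodic (fun i => by
      rw [Nat.cast_add, letter_add_convDen ha]),
      show convDen a (k + 1 + 1 + 1) = a (k + 2) * convDen a (k + 2) + convDen a (k + 1) from rfl,
      transfer_add]
    have hq : (0 : ℤ) < convDen a (k + 1) := convDen_int_pos ha k
    have h1 : (convDen a (k + 3) : ℤ) = a (k + 2) * convDen a (k + 2) + convDen a (k + 1) := by
      rw [convDen]; push_cast; ring
    congr 1
    · refine transfer_congr fun i hi => ?_
      have hi' : (i : ℤ) + 1 ≤ convDen a (k + 1) := by exact_mod_cast hi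
      have e1 := height_concat ha k (n := i) (by positivity) (by linarith)
      have e2 := height_concat ha k (n := i + 1) (by positivity) hi'
      rw [← add_assoc] at e2
      rw [letter, letter]
      push_cast
      rw [show k + 1 + 1 = k + 2 from rfl, e1, e2]
      push_cast
      ring
    · refine transfer_congr fun i hi => ?_
      have hi' : (i : ℤ) + 1 ≤ a (k + 2) * convDen a (k + 2) := by exact_mod_cast hi
      rw [letter, letter, height_succ_eq ha (k + 1) (by positivity) (by rw [h1]; linarith),
        height_succ_eq ha (k + 1) (by positivity) (by rw [h1]; linarith)]

theorem traces_eq_trace_monodromy (ha : ∀ k, 1 ≤ a (k + 1)) (V E : ℝ) (k : ℕ) :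
    trPrev V a k E = (monodromy V a E k).trace ∧ tr V a k E = (monodromy V a E (k + 1)).trace ∧
      trMul V a k E = (monodromy V a E k * monodromy V a E (k + 1)).trace := by
  induction k with
  | zero =>
    have h0 : monodromy V a E 1 = stepMatrix E 0 := by
      simp [monodromy, convDen, transfer, letter, height, convNum, parity]
    have h1 : monodromy V a E 0 = !![1, -V; 0, 1] := rfl
    rw [zero_add, h0, h1]
    refine ⟨?_, ?_, ?_⟩
    · simp [trPrev, traces, Matrix.trace_fin_two]; norm_num
    · simp [tr, traces, stepMatrix, Matrix.trace_fin_two]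
    · simp [trMul, traces, stepMatrix, Matrix.trace_fin_two, sub_eq_add_neg]
  | succ k ih =>
    obtain ⟨h1, h2, h3⟩ := ih
    refine ⟨h2, ?_, ?_⟩
    · rw [tr_succ, trChain, h1, h2, h3, chain_trace _ (det_monodromy _ _ _),
        ← monodromy_add_two ha]
    · rw [trMul_succ, trChain, h1, h2, h3, chain_trace _ (det_monodromy _ _ _), pow_succ,
        ← Matrix.mul_assoc, ← monodromy_add_two ha, Matrix.trace_mul_comm]

theorem potential_div {p q : ℤ} (hq : 0 < q) (hp : 0 ≤ p) (hpq : p ≤ q) (V : ℝ) (n : ℤ) :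
    potential ((p : ℝ) / q) V n = V * (((n + 1) * p / q - n * p / q : ℤ) : ℝ) := by
  obtain ⟨d, hd⟩ : ∃ d, d = n * p / q := ⟨_, rfl⟩
  obtain ⟨r, hr⟩ : ∃ r, r = n * p % q := ⟨_, rfl⟩
  have hr0 : 0 ≤ r := by rw [hr]; exact Int.emod_nonneg _ hq.ne'
  have hrq : r < q := by rw [hr]; exact Int.emod_lt_of_pos _ hq
  have hdr : n * p = q * d + r := by rw [hd, hr]; exact (Int.mul_ediv_add_emod _ _).symm
  have hqR : (0 : ℝ) < q := by exact_mod_cast hq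
  have hfr : Int.fract ((n : ℝ) * (p / q)) = r / q := by
    rw [Int.fract_eq_iff]
    refine ⟨by positivity, ?_, d, ?_⟩
    · rw [div_lt_one hqR]; exact_mod_cast hrq
    · have : (n : ℝ) * p = q * d + r := by exact_mod_cast hdr
      field_simp
      linarith
  have hfl : (n + 1) * p / q = d + if q ≤ r + p then 1 else 0 := by
    rw [Int.ediv_eq_iff_of_pos hq]
    split_ifs with h
    · constructor <;> nlinarith
    · constructor <;> nlinarith
  rw [potential, hfr, ← hd, hfl]
  by_cases h : q ≤ r + p
  · rw [Set.indicator_of_mem, if_pos h]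
    · simp
    · refine ⟨?_, ?_⟩
      · rw [← sub_nonneg, show (r : ℝ) / q - (1 - p / q) = (r + p - q) / q by field_simp; ring]
        have : (q : ℝ) ≤ r + p := by exact_mod_cast h
        exact div_nonneg (by linarith) hqR.le
      · rw [div_lt_one hqR]; exact_mod_cast hrq
  · rw [Set.indicator_of_notMem, if_neg h]
    · simp
    · intro hmem
      refine h ?_
      have h1 := hmem.1
      rw [← sub_nonneg, show (r : ℝ) / q - (1 - p / q) = (r + p - q) / q by field_simp; ring] at h1
      have h2 : (0 : ℝ) ≤ r + p - q := by
        by_contra hneg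
        exact absurd h1 (not_le.mpr (div_neg_of_neg_of_pos (not_le.mp hneg) hqR))
      have : (q : ℝ) ≤ r + p := by linarith
      exact_mod_cast this

/-- The potential is the mechanical word without offset. Since `p_k` and `q_k` are coprime, the
offset is an integer combination of them, hence amounts to a translation in `n`; `conv_det` supplies
the coefficients. -/
theorem exists_potential_eq_letter (ha : ∀ k, 1 ≤ a (k + 1)) (V : ℝ) (k : ℕ) :
    ∃ n₀ : ℤ, ∀ m : ℤ,
      potential ((convNum a (k + 1) : ℝ) / convDen a (k + 1)) V (n₀ + m) = V * letter a k m := by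
  obtain ⟨s, c, hsc⟩ : ∃ s c : ℤ,
      -parity k = s * convNum a (k + 1) + c * convDen a (k + 1) := by
    cases k with
    | zero => exact ⟨0, 0, by simp [parity]⟩
    | succ k =>
      rcases parity_eq k with h | h
      · refine ⟨-convDen a (k + 1), convNum a (k + 1), ?_⟩
        have := conv_det a k
        rw [parity, h] at *
        linarith
      · exact ⟨0, 0, by simp [parity, h]⟩
  have hq := convDen_int_pos ha k
  have hh : ∀ m : ℤ, height a k m
      = (m + 1 + s) * convNum a (k + 1) / convDen a (k + 1) + c := by
    intro m
    rw [height, ← Int.add_mul_ediv_right _ _ hq.ne']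
    congr 1
    linear_combination hsc
  refine ⟨1 + s, fun m => ?_⟩
  have := potential_div hq (p := convNum a (k + 1)) (by positivity)
    (by exact_mod_cast convNum_le_convDen ha k) V (1 + s + m)
  simp only [Int.cast_natCast] at this
  rw [this, letter, hh, hh]
  congr 2
  rw [show 1 + s + m + 1 = m + 1 + 1 + s by ring, show 1 + s + m = m + 1 + s by ring]
  ring

theorem potential_convergent_periodic (ha : ∀ k, 1 ≤ a (k + 1)) (V : ℝ) (k : ℕ) (n : ℤ) :
    potential ((convNum a (k + 1) : ℝ) / convDen a (k + 1)) V (n + convDen a (k + 1))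
      = potential ((convNum a (k + 1) : ℝ) / convDen a (k + 1)) V n := by
  obtain ⟨n₀, h⟩ := exists_potential_eq_letter ha V k
  have h1 := h (n - n₀ + convDen a (k + 1))
  have h2 := h (n - n₀)
  rw [letter_add_convDen ha, ← h2] at h1
  rwa [show n₀ + (n - n₀ + (convDen a (k + 1) : ℤ)) = n + convDen a (k + 1) by ring,
    show n₀ + (n - n₀) = n by ring] at h1

theorem spec_convergent (ha : ∀ k, 1 ≤ a (k + 1)) (V : ℝ) (k : ℕ) :
    spec ((convNum a (k + 1) : ℝ) / convDen a (k + 1)) V = {E | |tr V a k E| ≤ 2} := by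
  ext E
  obtain ⟨n₀, h⟩ := exists_potential_eq_letter ha V k
  rw [mem_spec_iff (convDen_pos ha k) (potential_convergent_periodic ha V k) n₀, Set.mem_ofPred_eq,
    (traces_eq_trace_monodromy ha V E k).2.1, monodromy]
  simp only [h]

end

/-! ### Continued fraction convergents and the level spectra -/

theorem exists_s_get (α : ℝ) (hirr : Irrational α) (k : ℕ) :
    1 ≤ cfCoeff α (k + 1) ∧ (GenContFract.of α).s.get? k = some ⟨1, cfCoeff α (k + 1)⟩ := by
  have hnt : ¬ (GenContFract.of α).TerminatedAt k := fun h =>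
    hirr (by
      obtain ⟨q, hq⟩ := (GenContFract.terminates_iff_rat α).mp ⟨k, h⟩
      exact ⟨q, hq.symm⟩)
  obtain ⟨gp, hgp⟩ := Option.ne_none_iff_exists'.mp hnt
  obtain ⟨h1, z, hz⟩ := GenContFract.of_partNum_eq_one_and_exists_int_partDen_eq hgp
  have hpd := GenContFract.partDen_eq_s_b hgp
  have hle := GenContFract.of_one_le_get?_partDen hpd
  have hc : cfCoeff α (k + 1) = ⌊gp.b⌋₊ := by rw [cfCoeff, hpd]; rfl
  have hz1 : 1 ≤ z := by rw [hz] at hle; exact_mod_cast hle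
  obtain ⟨n, rfl⟩ := Int.eq_ofNat_of_zero_le (zero_le_one.trans hz1)
  have hcn : cfCoeff α (k + 1) = n := by
    rw [hc, hz, Int.cast_natCast, Nat.floor_natCast]
  refine ⟨by rw [hcn]; exact_mod_cast hz1, ?_⟩
  rw [hgp, hcn]
  cases gp
  simp_all

theorem one_le_cfCoeff {α : ℝ} (hirr : Irrational α) (k : ℕ) : 1 ≤ cfCoeff α (k + 1) :=
  (exists_s_get α hirr k).1

theorem contsAux_eq {α : ℝ} (hα : α ∈ Set.Icc (0 : ℝ) 1) (hirr : Irrational α) (k : ℕ) :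
    (GenContFract.of α).contsAux k = ⟨convNum (cfCoeff α) k, convDen (cfCoeff α) k⟩ := by
  have : (GenContFract.of α).contsAux k = ⟨convNum (cfCoeff α) k, convDen (cfCoeff α) k⟩ ∧
      (GenContFract.of α).contsAux (k + 1)
        = ⟨convNum (cfCoeff α) (k + 1), convDen (cfCoeff α) (k + 1)⟩ := by
    induction k with
    | zero =>
      have h0 : ⌊α⌋ = 0 := Int.floor_eq_zero_iff.mpr ⟨hα.1, lt_of_le_of_ne hα.2 hirr.ne_one⟩
      refine ⟨?_, ?_⟩
      · rw [GenContFract.zeroth_contAux_eq_one_zero]; simp [convNum, convDen]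
      · rw [GenContFract.first_contAux_eq_h_one, GenContFract.of_h_eq_floor, h0]
        simp [convNum, convDen]
    | succ k ih =>
      refine ⟨ih.2, ?_⟩
      rw [GenContFract.contsAux_recurrence (exists_s_get α hirr k).2 ih.1 ih.2, convNum, convDen]
      push_cast
      simp
  exact this.1

theorem approximant_eq {α : ℝ} (hα : α ∈ Set.Icc (0 : ℝ) 1) (hirr : Irrational α) (k : ℕ) :
    approximant α k = (convNum (cfCoeff α) (k + 1) : ℝ) / convDen (cfCoeff α) (k + 1) := by
  rw [approximant, GenContFract.conv_eq_conts_a_div_conts_b,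
    GenContFract.nth_cont_eq_succ_nth_contAux, contsAux_eq hα hirr]

theorem levelSpec_natCast {α : ℝ} (hα : α ∈ Set.Icc (0 : ℝ) 1) (hirr : Irrational α) (V : ℝ)
    (k : ℕ) : levelSpec α V k = {E | |tr V (cfCoeff α) k E| ≤ 2} := by
  change spec (approximant α k) V = _
  rw [approximant_eq hα hirr, spec_convergent (one_le_cfCoeff hirr)]

/-! ### From crossings to spectral bands -/

theorem Crossing.isBand {α V : ℝ} (hα : α ∈ Set.Icc (0 : ℝ) 1) (hirr : Irrational α) {k : ℕ}
    {e : ℝ × ℝ} (he : Crossing (tr V (cfCoeff α) k) e.1 e.2) :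
    IsBand α V k (Set.Icc e.1 e.2) := by
  refine ⟨e.1, ?_, ?_⟩
  · rw [levelSpec_natCast hα hirr]; exact he.le _ he.left_mem
  · rw [levelSpec_natCast hα hirr, he.connectedComponentIn_eq he.left_mem]

theorem IsBand.exists_crossing {α V : ℝ} (hV : 0 < V) (hα : α ∈ Set.Icc (0 : ℝ) 1)
    (hirr : Irrational α) {k : ℕ} {I : Set ℝ} (h : IsBand α V k I) :
    ∃ e : ℝ × ℝ, I = Set.Icc e.1 e.2 ∧
      (CrossingA V (cfCoeff α) k e ∨ CrossingB V (cfCoeff α) k e) := by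
  obtain ⟨E, hE, rfl⟩ := h
  rw [levelSpec_natCast hα hirr] at hE ⊢
  obtain ⟨e, hEe, he⟩ := exists_mem_crossingA_or_crossingB hV (one_le_cfCoeff hirr) hE
  exact ⟨e, (he.elim CrossingA.crossing CrossingB.crossing).connectedComponentIn_eq hEe, he⟩

theorem strictlyIn_Icc {c d c' d' : ℝ} (h : c < d) :
    StrictlyIn (Set.Icc c d) (Set.Icc c' d') ↔ c' < c ∧ d < d' := by
  rw [StrictlyIn, interior_Icc, Set.Icc_subset_Ioo_iff h.le]

theorem isBand_negSucc (α V : ℝ) (n : ℕ) : IsBand α V (Int.negSucc n) Set.univ := by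
  refine ⟨0, Set.mem_univ _, ?_⟩
  change Set.univ = connectedComponentIn Set.univ 0
  rw [connectedComponentIn_univ, PreconnectedSpace.connectedComponent_eq_univ]

theorem CrossingA.isTypeA {α V : ℝ} (hα : α ∈ Set.Icc (0 : ℝ) 1) (hirr : Irrational α) {k : ℕ}
    {e : ℝ × ℝ} (he : CrossingA V (cfCoeff α) k e) : IsTypeA α V k (Set.Icc e.1 e.2) := by
  refine ⟨he.crossing.isBand hα hirr, ?_⟩
  cases k with
  | zero =>
    exact ⟨Set.univ, isBand_negSucc α V 0, by rw [StrictlyIn, interior_univ]; exact Set.subset_univ _⟩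
  | succ j =>
    obtain ⟨f, hf, h1, h2⟩ := he.parent j rfl
    refine ⟨Set.Icc f.1 f.2, ?_, (strictlyIn_Icc he.crossing.lt).mpr ⟨h1, h2⟩⟩
    rw [Nat.cast_succ, add_sub_cancel_right]
    exact hf.isBand hα hirr

/-- The containing band at level `k - 1` is itself a crossing of `t_{k-1}`, hence the bound; at
level `0`, `t_{-1}` is the constant `2`. -/
theorem IsTypeA.abs_trPrev_le {α V : ℝ} (hV : 0 < V) (hα : α ∈ Set.Icc (0 : ℝ) 1)
    (hirr : Irrational α) {k : ℕ} {I : Set ℝ} (h : IsTypeA α V k I) {x : ℝ} (hx : x ∈ I) :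
    |trPrev V (cfCoeff α) k x| ≤ 2 := by
  obtain ⟨-, J, hJ, hIJ⟩ := h
  cases k with
  | zero => simp [trPrev, traces]
  | succ j =>
    rw [Nat.cast_succ, add_sub_cancel_right] at hJ
    obtain ⟨f, rfl, hf⟩ := hJ.exists_crossing hV hα hirr
    exact (hf.elim CrossingA.crossing CrossingB.crossing).le x (interior_subset (hIJ hx))

theorem CrossingB.isTypeB {α V : ℝ} (hV : 0 < V) (hα : α ∈ Set.Icc (0 : ℝ) 1)
    (hirr : Irrational α) {k : ℕ} {e : ℝ × ℝ} (he : CrossingB V (cfCoeff α) k e) :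
    IsTypeB α V k (Set.Icc e.1 e.2) := by
  refine ⟨he.crossing.isBand hα hirr, fun hA => ?_, ?_⟩
  · obtain ⟨x, hx, hx2⟩ := he.two_lt
    exact absurd (hA.abs_trPrev_le hV hα hirr hx) (not_le.mpr hx2)
  · match k, he with
    | 0, _ =>
      exact ⟨Set.univ, isBand_negSucc α V 1,
        by rw [StrictlyIn, interior_univ]; exact Set.subset_univ _⟩
    | 1, _ =>
      exact ⟨Set.univ, isBand_negSucc α V 0,
        by rw [StrictlyIn, interior_univ]; exact Set.subset_univ _⟩
    | j + 2, he =>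
      obtain ⟨f, hf, h1, h2⟩ := he.parent j rfl
      refine ⟨Set.Icc f.1 f.2, ?_, (strictlyIn_Icc he.crossing.lt).mpr ⟨h1, h2⟩⟩
      rw [Nat.cast_add, Nat.cast_two, add_sub_cancel_right]
      exact hf.isBand hα hirr

theorem Children.hasInterlacingBands {α V : ℝ} (hV : 0 < V) (hα : α ∈ Set.Icc (0 : ℝ) 1)
    (hirr : Irrational α) {k p : ℕ} {e : ℝ × ℝ} {J : Fin p → ℝ × ℝ} {K : Fin (p + 1) → ℝ × ℝ}
    (h : Children V (cfCoeff α) k e p J K) :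
    HasInterlacingBands α V k (Set.Icc e.1 e.2) p := by
  refine ⟨fun j => Set.Icc (J j).1 (J j).2, fun j => Set.Icc (K j).1 (K j).2, fun j => ?_,
    fun j => ?_, fun j => ?_⟩
  · obtain ⟨h1, h2, h3⟩ := h.typeA j
    exact ⟨by exact_mod_cast h1.isTypeA hα hirr, (strictlyIn_Icc h1.crossing.lt).mpr ⟨h2, h3⟩⟩
  · obtain ⟨h1, h2, h3⟩ := h.typeB j
    exact ⟨by exact_mod_cast h1.isTypeB hV hα hirr, (strictlyIn_Icc h1.crossing.lt).mpr ⟨h2, h3⟩⟩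
  · obtain ⟨⟨h1, h2⟩, h3, h4⟩ := h.interlace j
    have hJ := (h.typeA j).1.crossing.lt.le
    have hK := fun i => (h.typeB i).1.crossing.lt.le
    exact ⟨⟨_, _, _, _, hK _, hJ, rfl, rfl, h1, h2⟩, ⟨_, _, _, _, hJ, hK _, rfl, rfl, h3, h4⟩⟩

end Sturmian

end

theorem theorem2 (V : ℝ) (hV : 0 < V) (α : ℝ) (hα : α ∈ Set.Icc (0 : ℝ) 1)
    (hirr : Irrational α) (k : ℕ) :
    (∀ I : Set ℝ, Sturmian.IsBand α V k I →
      Sturmian.IsTypeA α V k I ∨ Sturmian.IsTypeB α V k I) ∧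
    (∀ I : Set ℝ, Sturmian.IsBand α V k I →
      (Sturmian.IsTypeA α V k I →
        Sturmian.HasInterlacingBands α V k I (Sturmian.cfCoeff α (k + 1) - 1)) ∧
      (Sturmian.IsTypeB α V k I →
        Sturmian.HasInterlacingBands α V k I (Sturmian.cfCoeff α (k + 1)))) := by
  have ha := Sturmian.one_le_cfCoeff hirr
  refine ⟨fun I hI => ?_, fun I hI => ⟨fun hA => ?_, fun hB => ?_⟩⟩
  · obtain ⟨e, rfl, he⟩ := hI.exists_crossing hV hα hirr
    exact he.imp (fun h => h.isTypeA hα hirr) (fun h => h.isTypeB hV hα hirr)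
  · obtain ⟨e, rfl, he⟩ := hI.exists_crossing hV hα hirr
    obtain ⟨J, K, h⟩ := Sturmian.exists_children_of_abs_trPrev_le hV (ha k) (ha (k + 1))
      (he.elim Sturmian.CrossingA.crossing Sturmian.CrossingB.crossing)
      (fun x hx => hA.abs_trPrev_le hV hα hirr hx)
    exact h.hasInterlacingBands hV hα hirr
  · obtain ⟨e, rfl, he⟩ := hI.exists_crossing hV hα hirr
    rcases he with he | he
    -- A band is only known to come from a crossing of one of the two kinds; the kind A would
    -- contradict the negative clause of type B.
    · exact absurd (he.isTypeA hα hirr) hB.2.1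
    · obtain ⟨J, K, h⟩ := he.exists_children hV (ha (k + 1))
      exact h.hasInterlacingBands hV hα hirr
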